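/- Let $\Omega\subseteq\mathbb{C}$ be a simply connected domain, and let $\mathcal{H}_{l.u.}(\Omega)$ be the set of all locally univalent holomorphic functions on $\Omega$, that is, of all holomorphic $f:\Omega\to\mathbb{C}$ with $f'(z)\neq 0$ for every $z\in\Omega$, equipped with the topology of locally uniform convergence on $\Omega$. Let $\Phi$ be a family of locally univalent self-maps of $\Omega$ (holomorphic maps $\phi:\Omega\to\Omega$ with $\phi'(z)\ne 0$ for every $z\in\Omega$) which contains a sequence $(\phi_n)_{n\in\mathbb{N}}$ that is (i) run-away: for every compact set $K\subseteq\Omega$ there is an $n\in\mathbb{N}$ with $\phi_n(K)\cap K=\emptyset$; and (ii) eventually injective: for every compact set $K\subseteq\Omega$ there is an $N\in\mathbb{N}$ such that $\phi_n|_K$ is injective for all $n\ge N$. Call $G\in\mathcal{H}_{l.u.}(\Omega)$ $\Phi$-universal in $\mathcal{H}_{l.u.}(\Omega)$ if $\{G\circ\phi : \phi\in\Phi\}$ is dense in $\mathcal{H}_{l.u.}(\Omega)$. Then there is a $\Phi$-universal function in $\mathcal{H}_{l.u.}(\Omega)$, and the set of all $\Phi$-universal functions in $\mathcal{H}_{l.u.}(\Omega)$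 is a dense $G_\delta$-subset of $\mathcal{H}_{l.u.}(\Omega)$. -/

import Mathlib

open TopologicalSpace

namespace LocUniv

/-- `f : Ω → ℂ` is holomorphic on the open set `Ω ⊆ ℂ` with `f'(z) ≠ 0` for every `z ∈ Ω`.
Holomorphy and the derivative are those of an arbitrary extension `F` of `f` to the plane; as `Ω`
is open, they depend only on the values of `F` on `Ω`, that is, on `f`. -/
def IsLocallyUnivalent {Ω : Opens ℂ} (f : Ω → ℂ) : Prop :=
  ∃ F : ℂ → ℂ, (∀ z : Ω, F z = f z) ∧ DifferentiableOn ℂ F Ω ∧ ∀ z ∈ Ω, deriv F z ≠ 0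

/-- The self-map `φ` of `Ω` is locally univalent. -/
def IsLocallyUnivalentSelfMap {Ω : Opens ℂ} (φ : C(Ω, Ω)) : Prop :=
  IsLocallyUnivalent (fun z : Ω => (φ z : ℂ))

/-- The locally univalent holomorphic functions on `Ω`, as a subset of `C(Ω, ℂ)`, whose topology
in Mathlib is the compact-open one, that is, the topology of locally uniform convergence. -/
def Hlu (Ω : Opens ℂ) : Set C(Ω, ℂ) :=
  {f | IsLocallyUnivalent (f : Ω → ℂ)}

/-- A sequence of self-maps of `Ω` is run-away. -/
def IsRunAway {Ω : Opens ℂ} (φ : ℕ → C(Ω, Ω)) : Prop :=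
  ∀ K : Set Ω, IsCompact K → ∃ n, φ n '' K ∩ K = ∅

/-- A sequence of self-maps of `Ω` is eventually injective. -/
def IsEventuallyInjective {Ω : Opens ℂ} (φ : ℕ → C(Ω, Ω)) : Prop :=
  ∀ K : Set Ω, IsCompact K → ∃ N, ∀ n ≥ N, Set.InjOn (φ n) K

/-- The orbit `{G ∘ φ : φ ∈ Φ}`. -/
def orbit {Ω : Opens ℂ} (Φ : Set C(Ω, Ω)) (G : C(Ω, ℂ)) : Set C(Ω, ℂ) :=
  {g | ∃ φ ∈ Φ, g = G.comp φ}

/-- `G` is `Φ`-universal in `𝒢`: it belongs to `𝒢`, and its orbit is a dense subset of `𝒢`. -/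
def IsUniversalIn {Ω : Opens ℂ} (Φ : Set C(Ω, Ω)) (𝒢 : Set C(Ω, ℂ)) (G : C(Ω, ℂ)) : Prop :=
  G ∈ 𝒢 ∧ orbit Φ G ⊆ 𝒢 ∧ 𝒢 ⊆ closure (orbit Φ G)

end LocUniv

/-!
By Baire's theorem it is enough to show that the composition operators `G ↦ G ∘ φ n` are jointly
topologically transitive: given locally univalent `f`, `g` and a compact `K ⊆ Ω`, some locally
univalent `G` is close to `f` on `K` while `G ∘ φ` is close to `g` on `K`, for some `φ = φ n`.

Enlarge `K` to a compact `T ⊆ Ω` with connected complement on which functions are controlled by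
their derivatives up to constants, and choose `φ` injective near `T` with `φ(T)` disjoint from `T`.
Look for `G` entire with `G' = exp p`, `p` a polynomial, so that `G'` has no zero. On `T` the
polynomial `p` should approximate `log f'`, on `φ(T)` it should approximate `log (g' / φ') ∘ φ⁻¹`;
the logarithms exist because `Ω` is simply connected, and Runge's theorem applies because neither
`T` nor `φ(T)` separates the plane.

Then `G` and `G ∘ φ` approximate `f` and `g` up to one additive constant each. Only one of the two
constants can be chosen freely; for the other one, join `T` to `φ(T)` by a shortest segment `[k, l]`
and prescribe `p` on it as well, so that the integral of `exp p` along the segment comes close to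
the required difference `G(l) - G(k)`. The union `T ∪ φ(T) ∪ [k, l]` still does not separate the
plane. The prescribed values do not match at `k` and `l`, but the segment is a null set, so that the
Cauchy–Pompeiu formula still gives polynomials with uniformly bounded, pointwise convergent values
on it, and the integrals converge by dominated convergence.
-/

namespace LocUniv

open Set Filter Topology Complex MeasureTheory
open scoped ENNReal

/-! ### Continuous logarithms -/

section ContLog

variable {X : Type*} [TopologicalSpace X] {f g : X → ℂ} {K L : Set X}

/-- `f` has a continuous logarithm on `K`. For compact `K ⊆ ℂ`, the translates `w ↦ w - a` with
`a ∉ K` all have one exactly when the complement of `K` is connected; this replaces winding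
numbers. -/
def HasContLog (f : X → ℂ) (K : Set X) : Prop :=
  ∃ h : X → ℂ, ContinuousOn h K ∧ ∀ z ∈ K, exp (h z) = f z

theorem HasContLog.mono (hf : HasContLog f L) (hKL : K ⊆ L) : HasContLog f K := by
  obtain ⟨h, hc, he⟩ := hf
  exact ⟨h, hc.mono hKL, fun z hz => he z (hKL hz)⟩

theorem HasContLog.congr (hf : HasContLog f K) (hfg : EqOn f g K) : HasContLog g K := by
  obtain ⟨h, hc, he⟩ := hf
  exact ⟨h, hc, fun z hz => (he z hz).trans (hfg hz)⟩

theorem HasContLog.mul (hf : HasContLog f K) (hg : HasContLog g K) :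
    HasContLog (fun z => f z * g z) K := by
  obtain ⟨h, hc, he⟩ := hf
  obtain ⟨h', hc', he'⟩ := hg
  exact ⟨fun z => h z + h' z, hc.add hc', fun z hz => by rw [exp_add, he z hz, he' z hz]⟩

theorem hasContLog_const {c : ℂ} (hc : c ≠ 0) (K : Set X) : HasContLog (fun _ => c) K :=
  ⟨fun _ => log c, continuousOn_const, fun _ _ => exp_log hc⟩

theorem hasContLog_of_mem_slitPlane (hf : ContinuousOn f K) (h : ∀ z ∈ K, f z ∈ slitPlane) :
    HasContLog f K :=
  ⟨fun z => log (f z), hf.clog h, fun z hz => exp_log (slitPlane_ne_zero (h z hz))⟩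

theorem HasContLog.of_norm_sub_lt (hg : HasContLog g K) (hf : ContinuousOn f K)
    (hgc : ContinuousOn g K) (hfg : ∀ z ∈ K, ‖f z - g z‖ < ‖g z‖) : HasContLog f K := by
  have hg0 : ∀ z ∈ K, g z ≠ 0 := fun z hz => norm_pos_iff.1 ((norm_nonneg _).trans_lt (hfg z hz))
  have hquot : HasContLog (fun z => f z / g z) K := by
    refine hasContLog_of_mem_slitPlane (hf.div hgc hg0) fun z hz => ?_
    have hlt : ‖(f z - g z) / g z‖ < 1 := by
      rw [norm_div, div_lt_one (norm_pos_iff.2 (hg0 z hz))]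
      exact hfg z hz
    have hadd : f z / g z = 1 + (f z - g z) / g z := by field_simp [hg0 z hz]; ring
    rw [hadd]
    exact mem_slitPlane_of_norm_lt_one hlt
  exact (hg.mul hquot).congr fun z hz => mul_div_cancel₀ _ (hg0 z hz)

theorem hasContLog_of_isSimplyConnected [LocallyPathConnectedSpace X] (hK : IsSimplyConnected K)
    (hKo : IsOpen K) (hf : ContinuousOn f K) (hf0 : ∀ z ∈ K, f z ≠ 0) : HasContLog f K :=
  exists_continuousOn_eqOn_exp_comp hK hKo hf fun ⟨z, hz, hfz⟩ => hf0 z hz hfz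

end ContLog

theorem isSimplyConnected_univ_complex : IsSimplyConnected (univ : Set ℂ) :=
  have := (convex_univ (𝕜 := ℝ) (E := ℂ)).contractibleSpace univ_nonempty
  inferInstanceAs (SimplyConnectedSpace (univ : Set ℂ))

theorem not_hasContLog_sub_sphere (a : ℂ) {R : ℝ} (hR : 0 < R) :
    ¬ HasContLog (fun w => w - a) (Metric.sphere a R) := by
  rintro ⟨h, hc, he⟩
  have hmem : ∀ t : ℝ, a + R * exp (t * I) ∈ Metric.sphere a R := fun t => by
    simp [norm_exp_ofReal_mul_I, abs_of_pos hR]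
  set u : ℝ → ℂ := fun t => h (a + R * exp (t * I)) - t * I with hu
  have huc : Continuous u := (hc.comp_continuous (by fun_prop) hmem).sub (by fun_prop)
  have hexp : ∀ t, exp (u t) = R := fun t => by
    simp only [hu, exp_sub, he _ (hmem t), add_sub_cancel_left]
    exact mul_div_cancel_right₀ _ (exp_ne_zero _)
  have hconst : u = fun _ => u 0 :=
    isCoveringMap_exp.eq_of_comp_eq huc continuous_const (funext fun t => by simp [hexp]) 0 rfl
  have hperiod := congrFun hconst (2 * Real.pi)
  have hloop : exp (((2 * Real.pi : ℝ) : ℂ) * I) = 1 := by push_cast; exact exp_two_pi_mul_I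
  simp only [hu, hloop] at hperiod
  simp [Real.pi_ne_zero] at hperiod

theorem differentiableAt_of_differentiableAt_exp {h : ℂ → ℂ} {z : ℂ} (hc : ContinuousAt h z)
    (hd : DifferentiableAt ℂ (fun w => exp (h w)) z) : DifferentiableAt ℂ h z := by
  have hlog : DifferentiableAt ℂ (fun w => h z + log (exp (h w) / exp (h z))) z := by
    refine (DifferentiableAt.clog (hd.div_const _) ?_).const_add _
    rw [div_self (exp_ne_zero _)]
    exact one_mem_slitPlane
  have hnear : ∀ᶠ w in 𝓝 z, ‖h w - h z‖ < Real.pi := by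
    simpa [dist_eq] using hc.eventually (Metric.ball_mem_nhds _ Real.pi_pos)
  refine hlog.congr_of_eventuallyEq ?_
  filter_upwards [hnear] with w hw
  have him := abs_le.1 (abs_im_le_norm (h w - h z))
  rw [← exp_sub, log_exp (by linarith) (by linarith), add_sub_cancel]

/-! ### Components of the complement of a compact set -/

theorem frontier_connectedComponentIn_compl_subset {X : Type*} [TopologicalSpace X]
    [LocallyConnectedSpace X] {K : Set X} (hK : IsClosed K) (a : X) :
    frontier (connectedComponentIn Kᶜ a) ⊆ K := by
  intro x hx
  by_contra hxK
  obtain ⟨y, hyx, hya⟩ := mem_closure_iff.1 hx.1 _ hK.isOpen_compl.connectedComponentIn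
    (mem_connectedComponentIn hxK)
  have heq := (connectedComponentIn_eq hya).trans (connectedComponentIn_eq hyx).symm
  apply hx.2
  rw [hK.isOpen_compl.connectedComponentIn.interior_eq, heq]
  exact mem_connectedComponentIn hxK

section LogsAndComponents

variable {K : Set ℂ} {a b : ℂ}

/-- The logarithm is extended over the component by Tietze's theorem; its exponential glues with
`w - a` because the component has its frontier in `K`. -/
theorem exists_continuous_eqOn_compl_component (hK : IsClosed K) (ha : a ∉ K)
    (hl : HasContLog (fun w => w - a) K) : ∃ F : ℂ → ℂ, Continuous F ∧ (∀ w, F w ≠ 0) ∧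
      EqOn F (fun w => w - a) (connectedComponentIn Kᶜ a)ᶜ := by
  classical
  obtain ⟨h, hc, he⟩ := hl
  obtain ⟨H, hH⟩ := ContinuousMap.exists_restrict_eq hK
    (⟨K.domRestrict h, continuousOn_iff_continuous_domRestrict.1 hc⟩ : C(K, ℂ))
  have hHK : ∀ z ∈ K, H z = h z := fun z hz => DFunLike.congr_fun hH ⟨z, hz⟩
  set V := connectedComponentIn Kᶜ a with hV
  refine ⟨V.piecewise (fun w => exp (H w)) (fun w => w - a), ?_, fun w => ?_,
    fun w hw => piecewise_eq_of_notMem _ _ _ hw⟩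
  · refine Continuous.piecewise (fun w hw => ?_) (by fun_prop) (by fun_prop)
    have hwK := frontier_connectedComponentIn_compl_subset hK a hw
    rw [hHK w hwK, he w hwK]
  · by_cases hw : w ∈ V
    · simp [hw, exp_ne_zero]
    · rw [piecewise_eq_of_notMem _ _ _ hw, sub_ne_zero]
      rintro rfl
      exact hw (mem_connectedComponentIn ha)

theorem not_isBounded_component_of_hasContLog (hK : IsClosed K) (ha : a ∉ K)
    (hl : HasContLog (fun w => w - a) K) :
    ¬ Bornology.IsBounded (connectedComponentIn Kᶜ a) := by
  intro hb
  obtain ⟨F, hFc, hF0, hFa⟩ := exists_continuous_eqOn_compl_component hK ha hl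
  obtain ⟨R, hR, hVR⟩ := hb.subset_ball_lt 0 a
  have hsphere : Metric.sphere a R ⊆ (connectedComponentIn Kᶜ a)ᶜ := fun w hw hwV =>
    (Metric.mem_ball.1 (hVR hwV)).ne hw
  have hlog : HasContLog F univ := hasContLog_of_isSimplyConnected isSimplyConnected_univ_complex
    isOpen_univ hFc.continuousOn fun w _ => hF0 w
  exact not_hasContLog_sub_sphere a hR
    ((hlog.mono (subset_univ _)).congr fun w hw => hFa (hsphere hw))

theorem HasContLog.sub_const_of_norm_lt (hb : HasContLog (fun w => w - b) K)
    (h : ∀ z ∈ K, ‖b - a‖ < ‖z - b‖) : HasContLog (fun w => w - a) K :=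
  hb.of_norm_sub_lt (by fun_prop) (by fun_prop) fun z hz => by
    simpa only [sub_sub_sub_cancel_left] using h z hz

theorem eventually_hasContLog_sub_iff (hK : IsClosed K) (ha : a ∉ K) :
    ∀ᶠ b in 𝓝 a, HasContLog (fun w => w - a) K ↔ HasContLog (fun w => w - b) K := by
  obtain ⟨ε, hε, hball⟩ := Metric.isOpen_iff.1 hK.isOpen_compl a ha
  filter_upwards [Metric.ball_mem_nhds a (half_pos hε)] with b hb
  rw [Metric.mem_ball, dist_eq] at hb
  have hfar : ∀ z ∈ K, ε ≤ ‖z - a‖ := fun z hz => by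
    by_contra! hlt
    exact hball (by rwa [Metric.mem_ball, dist_eq]) hz
  have htri : ∀ z, ‖z - a‖ ≤ ‖z - b‖ + ‖b - a‖ := fun z => norm_sub_le_norm_sub_add_norm_sub z b a
  refine ⟨fun h => h.sub_const_of_norm_lt fun z hz => ?_,
    fun h => h.sub_const_of_norm_lt fun z hz => ?_⟩
  · rw [norm_sub_rev]; linarith [hfar z hz]
  · linarith [hfar z hz, htri z]

theorem exists_hasContLog_sub (hK : Bornology.IsBounded K) :
    ∃ b ∉ K, HasContLog (fun w => w - b) K := by
  obtain ⟨R, hR, hKR⟩ := hK.subset_ball_lt 0 0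
  have hnorm : ∀ z ∈ K, ‖z‖ < ‖(R : ℂ)‖ := fun z hz => by
    simpa [abs_of_pos hR] using hKR hz
  refine ⟨R, fun hRK => (hnorm _ hRK).ne rfl, ?_⟩
  exact (hasContLog_const (neg_ne_zero.2 (ofReal_ne_zero.2 hR.ne')) K).of_norm_sub_lt
    (by fun_prop) (by fun_prop) fun z hz => by simpa using hnorm z hz

theorem hasContLog_sub_of_isPreconnected_compl (hK : IsCompact K) (hc : IsPreconnected Kᶜ)
    (ha : a ∉ K) : HasContLog (fun w => w - a) K := by
  obtain ⟨b, hbK, hb⟩ := exists_hasContLog_sub hK.isBounded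
  refine (hc.induction₂ (fun a b => HasContLog (fun w => w - a) K ↔ HasContLog (fun w => w - b) K)
    (fun c hcK => ?_) (fun _ _ _ _ _ _ => Iff.trans) (fun _ _ _ _ => Iff.symm) ha hbK).2 hb
  exact (eventually_hasContLog_sub_iff hK.isClosed hcK).filter_mono nhdsWithin_le_nhds

end LogsAndComponents

section Fill

variable {E : Type*} [NormedAddCommGroup E] {K : Set E} {z : E}

/-- The topological hull of `K`: `K` together with the bounded components of its complement. -/
def fill (K : Set E) : Set E :=
  {z | z ∈ K ∨ Bornology.IsBounded (connectedComponentIn Kᶜ z)}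

theorem subset_fill (K : Set E) : K ⊆ fill K := fun _ => Or.inl

theorem component_subset_compl_fill (hz : z ∉ fill K) :
    connectedComponentIn Kᶜ z ⊆ (fill K)ᶜ := by
  rintro w hw (hwK | hwb)
  · exact connectedComponentIn_subset _ _ hw hwK
  · rw [← connectedComponentIn_eq hw] at hwb
    exact hz (Or.inr hwb)

theorem component_subset_fill (hz : z ∈ fill K) (hzK : z ∉ K) :
    connectedComponentIn Kᶜ z ⊆ fill K := by
  intro w hw
  refine Or.inr ?_
  rw [← connectedComponentIn_eq hw]
  exact hz.resolve_left hzK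

variable [NormedSpace ℝ E]

theorem isClosed_fill (hK : IsClosed K) : IsClosed (fill K) := by
  rw [← isOpen_compl_iff, isOpen_iff_mem_nhds]
  intro z hz
  have hzK : z ∈ Kᶜ := fun h => hz (Or.inl h)
  exact mem_of_superset
    (hK.isOpen_compl.connectedComponentIn.mem_nhds (mem_connectedComponentIn hzK))
    (component_subset_compl_fill hz)

theorem frontier_fill_subset (hK : IsClosed K) : frontier (fill K) ⊆ K := by
  intro z hz
  by_contra hzK
  have hzf : z ∈ fill K := (isClosed_fill hK).frontier_subset hz
  exact hz.2 (mem_interior_iff_mem_nhds.2 (mem_of_superset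
    (hK.isOpen_compl.connectedComponentIn.mem_nhds (mem_connectedComponentIn hzK))
    (component_subset_fill hzf hzK)))

theorem isPreconnected_compl_closedBall_zero (hE : 1 < Module.rank ℝ E) {R : ℝ} (hR : 0 ≤ R) :
    IsPreconnected (Metric.closedBall (0 : E) R)ᶜ := by
  have hpolar : (Metric.closedBall (0 : E) R)ᶜ =
      (fun p : ℝ × E => p.1 • p.2) '' (Ioi R ×ˢ Metric.sphere 0 1) := by
    ext w
    simp only [mem_compl_iff, Metric.mem_closedBall, dist_zero_right, not_le, mem_image, mem_prod,
      mem_Ioi, mem_sphere_iff_norm, sub_zero, Prod.exists]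
    constructor
    · intro hw
      have hw0 : ‖w‖ ≠ 0 := (hR.trans_lt hw).ne'
      exact ⟨‖w‖, ‖w‖⁻¹ • w, ⟨hw, by simp [norm_smul, hw0]⟩, smul_inv_smul₀ hw0 w⟩
    · rintro ⟨r, x, ⟨hr, hx⟩, rfl⟩
      rwa [norm_smul, hx, mul_one, Real.norm_of_nonneg (hR.trans hr.le)]
  rw [hpolar]
  exact (isPreconnected_Ioi.prod (isPreconnected_sphere hE 0 1)).image _
    continuous_smul.continuousOn

theorem isBounded_fill (hE : 1 < Module.rank ℝ E) (hK : Bornology.IsBounded K) :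
    Bornology.IsBounded (fill K) := by
  obtain ⟨R, hR, hKR⟩ := hK.subset_closedBall_lt 0 0
  refine (Metric.isBounded_closedBall (x := (0 : E)) (r := R)).subset fun z hz => ?_
  by_contra hzR
  rcases hz with hzK | hzb
  · exact hzR (hKR hzK)
  · have hout := (isPreconnected_compl_closedBall_zero hE hR.le).subset_connectedComponentIn
      hzR (compl_subset_compl.2 hKR)
    have hunion := (hzb.subset hout).union (Metric.isBounded_closedBall (x := 0) (r := R))
    rw [compl_union_self] at hunion
    have : Nontrivial E := (rank_pos_iff_nontrivial (R := ℝ)).1 (zero_lt_one.trans hE)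
    exact NormedSpace.unbounded_univ ℝ E hunion

theorem isCompact_fill [ProperSpace E] (hE : 1 < Module.rank ℝ E) (hK : IsCompact K) :
    IsCompact (fill K) :=
  Metric.isCompact_of_isClosed_isBounded (isClosed_fill hK.isClosed)
    (isBounded_fill hE hK.isBounded)

theorem isPreconnected_compl_of_forall_not_isBounded (hE : 1 < Module.rank ℝ E)
    (hK : Bornology.IsBounded K)
    (h : ∀ a ∉ K, ¬ Bornology.IsBounded (connectedComponentIn Kᶜ a)) : IsPreconnected Kᶜ := by
  obtain ⟨R, hR, hKR⟩ := hK.subset_closedBall_lt 0 0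
  have hout := isPreconnected_compl_closedBall_zero hE hR.le
  have hreach : ∀ a ∉ K, (connectedComponentIn Kᶜ a ∩ (Metric.closedBall 0 R)ᶜ).Nonempty := by
    intro a ha
    rw [inter_compl_nonempty_iff]
    exact fun hsub => h a ha (Metric.isBounded_closedBall.subset hsub)
  refine isPreconnected_of_forall_pair fun x hx y hy => ?_
  obtain ⟨u, hux, huR⟩ := hreach x hx
  obtain ⟨v, hvy, hvR⟩ := hreach y hy
  refine ⟨connectedComponentIn Kᶜ x ∪ (Metric.closedBall 0 R)ᶜ ∪ connectedComponentIn Kᶜ y,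
    union_subset (union_subset (connectedComponentIn_subset _ _) (compl_subset_compl.2 hKR))
      (connectedComponentIn_subset _ _), Or.inl (Or.inl (mem_connectedComponentIn hx)),
    Or.inr (mem_connectedComponentIn hy), ?_⟩
  exact (isPreconnected_connectedComponentIn.union u hux huR hout).union v (Or.inr hvR) hvy
    isPreconnected_connectedComponentIn

theorem isPreconnected_compl_fill (hE : 1 < Module.rank ℝ E) (hK : Bornology.IsBounded K) :
    IsPreconnected (fill K)ᶜ := by
  refine isPreconnected_compl_of_forall_not_isBounded hE (isBounded_fill hE hK) fun a ha hb => ?_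
  have haK : a ∈ Kᶜ := fun h => ha (Or.inl h)
  exact ha (Or.inr (hb.subset (isPreconnected_connectedComponentIn.subset_connectedComponentIn
    (mem_connectedComponentIn haK) (component_subset_compl_fill ha))))

end Fill

theorem one_lt_rank_real_complex : 1 < Module.rank ℝ ℂ :=
  rank_real_complex ▸ Nat.one_lt_ofNat

theorem isPreconnected_compl_of_hasContLog {K : Set ℂ} (hK : IsCompact K)
    (h : ∀ a ∉ K, HasContLog (fun w => w - a) K) : IsPreconnected Kᶜ :=
  isPreconnected_compl_of_forall_not_isBounded one_lt_rank_real_complex hK.isBounded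
    fun a ha => not_isBounded_component_of_hasContLog hK.isClosed ha (h a ha)

section SimplyConnected

variable {U : Set ℂ}

theorem exists_differentiableOn_log (hU : IsSimplyConnected U) (hUo : IsOpen U) {f : ℂ → ℂ}
    (hf : DifferentiableOn ℂ f U) (hf0 : ∀ z ∈ U, f z ≠ 0) :
    ∃ h : ℂ → ℂ, DifferentiableOn ℂ h U ∧ ∀ z ∈ U, exp (h z) = f z := by
  obtain ⟨h, hc, he⟩ := hasContLog_of_isSimplyConnected hU hUo hf.continuousOn hf0
  refine ⟨h, fun z hz => DifferentiableAt.differentiableWithinAt ?_, he⟩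
  have hUz := hUo.mem_nhds hz
  exact differentiableAt_of_differentiableAt_exp (hc.continuousAt hUz)
    ((hf.differentiableAt hUz).congr_of_eventuallyEq (eventually_of_mem hUz he))

theorem fill_subset_of_isSimplyConnected (hU : IsSimplyConnected U) (hUo : IsOpen U) {K : Set ℂ}
    (hK : IsClosed K) (hKU : K ⊆ U) : fill K ⊆ U := by
  rintro a (haK | hab)
  · exact hKU haK
  by_contra haU
  refine not_isBounded_component_of_hasContLog hK (fun haK => haU (hKU haK)) ?_ hab
  exact (hasContLog_of_isSimplyConnected hU hUo (by fun_prop)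
    fun z hz h0 => haU (by rwa [← sub_eq_zero.1 h0])).mono hKU

end SimplyConnected

/-! ### The Cauchy–Pompeiu formula -/

section Dbar

variable {E : Type*} [NormedAddCommGroup E] [NormedSpace ℂ E] {h : ℂ → E}

/-- The Wirtinger derivative `∂h/∂w̄ = (∂h/∂x + i ∂h/∂y) / 2`, which vanishes where `h` is
holomorphic. -/
noncomputable def dbar (h : ℂ → E) (w : ℂ) : E :=
  (2⁻¹ : ℂ) • (fderiv ℝ h w 1 + I • fderiv ℝ h w I)

theorem dbar_eq_zero_of_differentiableAt {w : ℂ} (hw : DifferentiableAt ℂ h w) :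
    dbar h w = 0 := by
  have hreal : fderiv ℝ h w = (fderiv ℂ h w).restrictScalars ℝ :=
    (hw.hasFDerivAt.restrictScalars ℝ).fderiv
  have hI : fderiv ℂ h w I = I • fderiv ℂ h w 1 := by rw [← map_smul, smul_eq_mul, mul_one]
  rw [dbar, hreal, ContinuousLinearMap.coe_restrictScalars', hI, smul_smul, I_mul_I, neg_one_smul,
    add_neg_cancel, smul_zero]

theorem continuous_dbar (hh : ContDiff ℝ 1 h) : Continuous (dbar h) := by
  have := hh.continuous_fderiv one_ne_zero
  unfold dbar
  fun_prop

theorem tsupport_dbar_subset : tsupport (dbar h) ⊆ tsupport h := by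
  refine (closure_mono fun w hw => ?_).trans (tsupport_fderiv_subset ℝ (f := h))
  contrapose! hw
  rw [Function.notMem_support] at hw ⊢
  simp [dbar, hw]

theorem dbar_polar (w : ℂ) (θ : ℝ) :
    exp (-(θ * I)) • dbar h w =
      (2⁻¹ : ℂ) • (fderiv ℝ h w (exp (θ * I)) + I • fderiv ℝ h w (I * exp (θ * I))) := by
  have hexp : exp (θ * I) = Real.cos θ • (1 : ℂ) + Real.sin θ • I := by
    rw [exp_mul_I]; simp
  have hIexp : I * exp (θ * I) = (-Real.sin θ) • (1 : ℂ) + Real.cos θ • I := by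
    rw [hexp]
    simp only [real_smul, ofReal_neg]
    linear_combination (Real.sin θ : ℂ) * I_mul_I
  have hexp_neg : exp (-(θ * I)) = Real.cos θ - Real.sin θ * I := by
    rw [← neg_mul, exp_mul_I, cos_neg, sin_neg]
    push_cast
    ring
  rw [hIexp, hexp, hexp_neg, dbar]
  simp only [map_add, map_smul]
  simp only [← Complex.coe_smul]
  match_scalars
  · ring
  · linear_combination (-sin θ / 2) * I_mul_I

end Dbar

section PolarIntegrals

variable {E : Type*} [NormedAddCommGroup E] {h : ℂ → E}

theorem integrableOn_polarCoord_target {f : ℝ × ℝ → E} (hf : Continuous f) {R : ℝ}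
    (hR : ∀ p, R < p.1 → f p = 0) : IntegrableOn f polarCoord.target := by
  have hcompact : IsCompact (Icc (0 : ℝ) R ×ˢ Icc (-Real.pi) Real.pi) :=
    isCompact_Icc.prod isCompact_Icc
  refine (hf.continuousOn.integrableOn_compact hcompact).of_forall_sdiff_eq_zero
    (measurableSet_Ioi.prod measurableSet_Ioo) fun p hp => hR p ?_
  by_contra! hle
  exact hp.2 ⟨⟨hp.1.1.le, hle⟩, Ioo_subset_Icc_self hp.1.2⟩

theorem exists_forall_add_mul_exp_notMem {K : Set ℂ} (hK : Bornology.IsBounded K) (z : ℂ) :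
    ∃ R : ℝ, ∀ r θ : ℝ, R < r → z + r * exp (θ * I) ∉ K := by
  obtain ⟨R, hKR⟩ := hK.subset_closedBall z
  refine ⟨R, fun r θ hr hm => ?_⟩
  have hle : |r| ≤ R := by simpa [norm_exp_ofReal_mul_I] using hKR hm
  exact hr.not_ge ((le_abs_self r).trans hle)

variable [NormedSpace ℝ E]

theorem hasDerivAt_comp_radius (hh : Differentiable ℝ h) (z : ℂ) (r θ : ℝ) :
    HasDerivAt (fun r : ℝ => h (z + r * exp (θ * I)))
      (fderiv ℝ h (z + r * exp (θ * I)) (exp (θ * I))) r := by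
  refine (hh _).hasFDerivAt.comp_hasDerivAt r (HasDerivAt.const_add z ?_)
  simpa using (hasDerivAt_id r).ofReal_comp.mul_const (exp (θ * I))

theorem hasDerivAt_comp_angle (hh : Differentiable ℝ h) (z : ℂ) (r θ : ℝ) :
    HasDerivAt (fun θ : ℝ => h (z + r * exp (θ * I)))
      (r • fderiv ℝ h (z + r * exp (θ * I)) (I * exp (θ * I))) θ := by
  rw [← map_smul]
  refine (hh _).hasFDerivAt.comp_hasDerivAt θ (HasDerivAt.const_add z ?_)
  simpa [mul_comm] using ((hasDerivAt_id θ).ofReal_comp.mul_const I).cexp.const_mul (r : ℂ)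

theorem integrableOn_polarCoord_target_fderiv (hh : ContDiff ℝ 1 h) (hs : HasCompactSupport h)
    (z : ℂ) {v : ℝ → ℂ} (hv : Continuous v) :
    IntegrableOn (fun p => fderiv ℝ h (z + p.1 * exp (p.2 * I)) (v p.2)) polarCoord.target := by
  have := hh.continuous_fderiv one_ne_zero
  obtain ⟨R, hR⟩ := exists_forall_add_mul_exp_notMem hs.isCompact.isBounded z
  refine integrableOn_polarCoord_target (R := R) (by fun_prop) fun p hp => ?_
  have hfderiv : fderiv ℝ h (z + p.1 * exp (p.2 * I)) = 0 :=
    image_eq_zero_of_notMem_tsupport fun hm => hR p.1 p.2 hp (tsupport_fderiv_subset ℝ hm)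
  rw [hfderiv, zero_apply]

variable [CompleteSpace E]

theorem integral_Ioi_fderiv_radius (hh : ContDiff ℝ 1 h) (hs : HasCompactSupport h) (z : ℂ)
    (θ : ℝ) : ∫ r in Ioi (0 : ℝ), fderiv ℝ h (z + r * exp (θ * I)) (exp (θ * I)) = -h z := by
  have hray : IsClosedEmbedding fun r : ℝ => z + r * exp (θ * I) := by
    refine Isometry.isClosedEmbedding (Isometry.of_dist_eq fun r s => ?_)
    rw [dist_add_left, dist_eq, ← sub_mul, norm_mul, norm_exp_ofReal_mul_I, mul_one, ← ofReal_sub,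
      norm_real, Real.dist_eq, Real.norm_eq_abs]
  have hofReal : ContDiff ℝ 1 fun r : ℝ => (r : ℂ) := ofRealCLM.contDiff
  have hftc := HasCompactSupport.integral_Ioi_deriv_eq (f := fun r : ℝ => h (z + r * exp (θ * I)))
    (hh.comp (contDiff_const.add (hofReal.mul contDiff_const))) (hs.comp_isClosedEmbedding hray) 0
  simpa only [(hasDerivAt_comp_radius (hh.differentiable one_ne_zero) z _ θ).deriv, ofReal_zero,
    zero_mul, add_zero] using hftc

theorem integral_Ioo_fderiv_angle (hh : ContDiff ℝ 1 h) (z : ℂ) {r : ℝ} (hr : r ≠ 0) :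
    ∫ θ in Ioo (-Real.pi) Real.pi, fderiv ℝ h (z + r * exp (θ * I)) (I * exp (θ * I)) = 0 := by
  have := hh.continuous_fderiv one_ne_zero
  refine (smul_eq_zero.1 ?_).resolve_left hr
  rw [← integral_Ioc_eq_integral_Ioo, ← intervalIntegral.integral_of_le
      (neg_le_self Real.pi_pos.le), ← intervalIntegral.integral_smul,
    intervalIntegral.integral_eq_sub_of_hasDerivAt
      fun θ _ => hasDerivAt_comp_angle (hh.differentiable one_ne_zero) z r θ]
  · simp [exp_neg]
  · exact Continuous.intervalIntegrable (by fun_prop) _ _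

theorem integral_polarCoord_target_fderiv_radius (hh : ContDiff ℝ 1 h)
    (hs : HasCompactSupport h) (z : ℂ) :
    ∫ p in polarCoord.target, fderiv ℝ h (z + p.1 * exp (p.2 * I)) (exp (p.2 * I)) =
      -((2 * Real.pi) • h z) := by
  have hint := integrableOn_polarCoord_target_fderiv hh hs z
    (v := fun θ : ℝ => exp (θ * I)) (by fun_prop)
  rw [polarCoord_target, Measure.volume_eq_prod] at hint ⊢
  have hswap : IntegrableOn (fun p : ℝ × ℝ => fderiv ℝ h (z + p.2 * exp (p.1 * I))
      (exp (p.1 * I))) (Ioo (-Real.pi) Real.pi ×ˢ Ioi 0) (volume.prod volume) := by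
    rw [IntegrableOn, ← Measure.prod_restrict] at hint ⊢
    exact hint.swap
  rw [← setIntegral_prod_swap]
  refine (setIntegral_prod _ hswap).trans ?_
  simp only [integral_Ioi_fderiv_radius hh hs z, setIntegral_const, smul_neg,
    Real.volume_real_Ioo_of_le (neg_le_self Real.pi_pos.le), sub_neg_eq_add, two_mul]

theorem integral_polarCoord_target_fderiv_angle (hh : ContDiff ℝ 1 h) (hs : HasCompactSupport h)
    (z : ℂ) :
    ∫ p in polarCoord.target, fderiv ℝ h (z + p.1 * exp (p.2 * I)) (I * exp (p.2 * I)) = 0 := by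
  have hint := integrableOn_polarCoord_target_fderiv hh hs z
    (v := fun θ : ℝ => I * exp (θ * I)) (by fun_prop)
  rw [polarCoord_target, Measure.volume_eq_prod] at hint ⊢
  rw [setIntegral_prod _ hint]
  exact setIntegral_eq_zero_of_forall_eq_zero fun r hr =>
    integral_Ioo_fderiv_angle hh z (mem_Ioi.1 hr).ne'

end PolarIntegrals

section CauchyPompeiu

variable {E : Type*} [NormedAddCommGroup E] [NormedSpace ℂ E] {h : ℂ → E}

theorem smul_inv_smul_dbar_polarCoord_symm (h : ℂ → E) (z : ℂ) {p : ℝ × ℝ} (hp : p.1 ≠ 0) :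
    p.1 • ((Complex.polarCoord.symm p)⁻¹ • dbar h (z + Complex.polarCoord.symm p)) =
      (2⁻¹ : ℂ) • (fderiv ℝ h (z + p.1 * exp (p.2 * I)) (exp (p.2 * I)) +
        I • fderiv ℝ h (z + p.1 * exp (p.2 * I)) (I * exp (p.2 * I))) := by
  have hsymm : Complex.polarCoord.symm p = p.1 * exp (p.2 * I) := by
    rw [Complex.polarCoord_symm_apply, exp_mul_I]; simp
  rw [hsymm, ← dbar_polar, ← Complex.coe_smul, smul_smul, mul_inv, exp_neg,
    mul_inv_cancel_left₀ (ofReal_ne_zero.2 hp)]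

/-- In polar coordinates around `z`, the integrand is half the sum of a radial derivative, which
integrates to `-h z` along each ray, and of an angular one, which integrates to `0` along each
circle. -/
theorem integral_inv_smul_dbar [CompleteSpace E] (hh : ContDiff ℝ 1 h) (hs : HasCompactSupport h)
    (z : ℂ) : ∫ w, w⁻¹ • dbar h (z + w) = -(Real.pi • h z) := by
  have hradius := integrableOn_polarCoord_target_fderiv hh hs z
    (v := fun θ : ℝ => exp (θ * I)) (by fun_prop)
  have hangle : IntegrableOn (fun p : ℝ × ℝ =>
      I • fderiv ℝ h (z + p.1 * exp (p.2 * I)) (I * exp (p.2 * I))) polarCoord.target :=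
    (integrableOn_polarCoord_target_fderiv hh hs z
      (v := fun θ : ℝ => I * exp (θ * I)) (by fun_prop)).smul I
  rw [← Complex.integral_comp_polarCoord_symm,
    setIntegral_congr_fun polarCoord.open_target.measurableSet
      fun p hp => smul_inv_smul_dbar_polarCoord_symm h z (mem_Ioi.1 hp.1).ne',
    integral_smul, integral_add hradius hangle, integral_smul,
    integral_polarCoord_target_fderiv_radius hh hs, integral_polarCoord_target_fderiv_angle hh hs,
    smul_zero, add_zero, smul_neg, ← Complex.coe_smul, ← Complex.coe_smul, smul_smul]
  push_cast
  rw [inv_mul_cancel_left₀ two_ne_zero]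

end CauchyPompeiu

/-! ### Polynomial approximation -/

section Resolvent

theorem resolvent_mem_of_isPreconnected_compl {A : Type*} [NormedRing A] [CompleteSpace A]
    [NormedAlgebra ℂ A] {S : Subalgebra ℂ A} (hS : IsClosed (S : Set A)) {x : A} (hx : x ∈ S)
    (hc : IsPreconnected (spectrum ℂ x)ᶜ) {w : ℂ} (hw : w ∉ spectrum ℂ x) :
    resolvent x w ∈ S := by
  have := hS
  have hunit : IsUnit (algebraMap ℂ S w - ⟨x, hx⟩) := by
    rwa [← spectrum.notMem_iff, Subalgebra.spectrum_eq_of_isPreconnected_compl S ⟨x, hx⟩ hc]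
  obtain ⟨v, hv⟩ := hunit.exists_right_inv
  have hxv : (algebraMap ℂ A w - x) * v = 1 := congrArg Subtype.val hv
  have hinv : resolvent x w * (algebraMap ℂ A w - x) = 1 :=
    Ring.inverse_mul_cancel _ (spectrum.notMem_iff.1 hw)
  rw [left_inv_eq_right_inv hinv hxv]
  exact v.2

theorem integral_mem_of_isClosed {α F : Type*} [MeasurableSpace α] {μ : Measure α}
    [NormedAddCommGroup F] [NormedSpace ℝ F] [CompleteSpace F] {S : Submodule ℝ F}
    (hS : IsClosed (S : Set F)) {f : α → F} (hf : ∀ᵐ a ∂μ, f a ∈ S) : ∫ a, f a ∂μ ∈ S := by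
  by_cases hint : Integrable f μ
  · have := hS
    have hzero : ∫ a, S.mkQL (f a) ∂μ = 0 := by
      refine integral_eq_zero_of_ae (hf.mono fun a ha => ?_)
      simpa using ha
    rw [S.mkQL.integral_comp_comm hint] at hzero
    simpa using hzero
  · rw [integral_undef hint]
    exact S.zero_mem

variable {E : Set ℂ}

open Polynomial in
/-- The inclusion of `E` into the plane, as an element of the algebra `C(E, ℂ)`. -/
noncomputable abbrev coordFun (E : Set ℂ) : C(E, ℂ) := toContinuousMapOn X E

theorem spectrum_coordFun : spectrum ℂ (coordFun E) = E := by
  rw [ContinuousMap.spectrum_eq_range]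
  ext w
  simp

theorem resolvent_coordFun_apply {w : ℂ} (hw : w ∉ E) (z : E) :
    resolvent (coordFun E) w z = (w - z)⁻¹ := by
  have hunit : IsUnit (algebraMap ℂ C(E, ℂ) w - coordFun E) := by
    rwa [← spectrum.notMem_iff, spectrum_coordFun]
  have hz := DFunLike.congr_fun (Ring.mul_inverse_cancel _ hunit) z
  refine (inv_eq_of_mul_eq_one_right ?_).symm
  simpa [resolvent] using hz

variable [CompactSpace E]

theorem continuousOn_resolvent_coordFun : ContinuousOn (resolvent (coordFun E)) Eᶜ := by
  intro w hw
  rw [← spectrum_coordFun (E := E)] at hw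
  exact (spectrum.hasDerivAt_resolvent_const_left (not_not.1 hw)).continuousAt.continuousWithinAt

theorem resolvent_coordFun_mem (hc : IsPreconnected Eᶜ) {w : ℂ} (hw : w ∉ E) :
    resolvent (coordFun E) w ∈ (polynomialFunctions E).topologicalClosure := by
  refine resolvent_mem_of_isPreconnected_compl (Subalgebra.isClosed_topologicalClosure _)
    (Subalgebra.le_topologicalClosure _ (Set.mem_image_of_mem _ (mem_univ Polynomial.X))) ?_ ?_
  · rwa [spectrum_coordFun]
  · rwa [spectrum_coordFun]

theorem exists_polynomial_norm_eval_sub_lt {f : C(E, ℂ)}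
    (hf : f ∈ (polynomialFunctions E).topologicalClosure) {ε : ℝ} (hε : 0 < ε) :
    ∃ p : Polynomial ℂ, ∀ z : E, ‖p.eval (z : ℂ) - f z‖ < ε := by
  obtain ⟨_, ⟨p, -, rfl⟩, hp⟩ := Metric.mem_closure_iff.1 (show f ∈ closure _ from hf) ε hε
  refine ⟨p, fun z => ?_⟩
  rw [← dist_eq, dist_comm]
  exact (ContinuousMap.dist_apply_le_dist z).trans_lt hp

end Resolvent

section CauchyTransform

theorem exists_polynomial_approx_setIntegral {E A : Set ℂ} (hE : IsCompact E)
    (hc : IsPreconnected Eᶜ) (hA : IsCompact A) (hAE : A ⊆ Eᶜ) {g : ℂ → ℂ}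
    (hg : ContinuousOn g A) {ε : ℝ} (hε : 0 < ε) :
    ∃ p : Polynomial ℂ, ∀ z ∈ E, ‖p.eval z - ∫ w in A, g w * (w - z)⁻¹‖ < ε := by
  have : CompactSpace E := isCompact_iff_compactSpace.1 hE
  set P := (polynomialFunctions E).topologicalClosure
  have hgr : ContinuousOn (fun w => g w • resolvent (coordFun E) w) A :=
    hg.smul (continuousOn_resolvent_coordFun.mono hAE)
  have hmem : ∫ w in A, g w • resolvent (coordFun E) w ∈ P := by
    refine integral_mem_of_isClosed (S := (Subalgebra.toSubmodule P).restrictScalars ℝ)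
      (Subalgebra.isClosed_topologicalClosure _) (ae_restrict_of_forall_mem hA.measurableSet ?_)
    exact fun w hw => P.smul_mem (resolvent_coordFun_mem hc (hAE hw)) _
  obtain ⟨p, hp⟩ := exists_polynomial_norm_eval_sub_lt hmem hε
  refine ⟨p, fun z hz => ?_⟩
  convert hp ⟨z, hz⟩ using 3
  rw [← ContinuousMap.evalCLM_apply ℂ,
    ← ContinuousLinearMap.integral_comp_comm _ (hgr.integrableOn_compact hA)]
  refine setIntegral_congr_fun hA.measurableSet fun w hw => ?_
  simp [resolvent_coordFun_apply (hAE hw)]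

theorem setLIntegral_ball_enorm_inv_ne_top (R : ℝ) :
    ∫⁻ w in Metric.ball (0 : ℂ) R, ‖w⁻¹‖ₑ ≠ ∞ := by
  have hint : IntegrableOn (fun w : ℂ => ‖w‖⁻¹) (Metric.ball 0 R) := by
    rw [integrableOn_fun_norm_addHaar volume (f := fun r : ℝ => r⁻¹), finrank_real_complex]
    refine (integrableOn_congr_fun (g := fun _ => (1 : ℝ)) (fun r hr => ?_) measurableSet_Ioo).2
      (integrableOn_const (by simp))
    simp [hr.1.ne']
  simpa only [HasFiniteIntegral, enorm_norm, ← norm_inv] using hint.2.ne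

theorem setLIntegral_enorm_inv_le (B : Set ℂ) :
    ∫⁻ w in B, ‖w⁻¹‖ₑ ≤ (∫⁻ w in B ∩ Metric.ball 0 1, ‖w⁻¹‖ₑ) + volume B := by
  rw [← lintegral_inter_add_sdiff _ B measurableSet_ball]
  gcongr
  calc ∫⁻ w in B \ Metric.ball 0 1, ‖w⁻¹‖ₑ ≤ ∫⁻ _ in B \ Metric.ball 0 1, 1 := by
        refine setLIntegral_mono_ae aemeasurable_const (.of_forall fun w hw => ?_)
        rw [Set.mem_sdiff, mem_ball_zero_iff, not_lt] at hw
        rw [← ofReal_norm, norm_inv]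
        exact ENNReal.ofReal_le_one.2 (inv_le_one_of_one_le₀ hw.2)
    _ ≤ volume B := by
        rw [setLIntegral_one]
        exact measure_mono sdiff_subset

theorem setLIntegral_enorm_sub_inv (z : ℂ) (B : Set ℂ) :
    ∫⁻ w in B, ‖(w - z)⁻¹‖ₑ = ∫⁻ w in (· + z) ⁻¹' B, ‖w⁻¹‖ₑ := by
  simpa using ((measurePreserving_add_right volume z).setLIntegral_comp_preimage_emb
    (measurableEmbedding_addRight z) (fun w => ‖(w - z)⁻¹‖ₑ) B).symm

theorem setLIntegral_enorm_sub_inv_lt_top (z : ℂ) {B : Set ℂ} (hB : volume B ≠ ∞) :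
    ∫⁻ w in B, ‖(w - z)⁻¹‖ₑ < ∞ := by
  rw [setLIntegral_enorm_sub_inv]
  refine (setLIntegral_enorm_inv_le _).trans_lt (ENNReal.add_lt_top.2 ⟨?_, ?_⟩)
  · exact (lintegral_mono_set inter_subset_right).trans_lt
      (setLIntegral_ball_enorm_inv_ne_top 1).lt_top
  · rwa [measure_preimage_add_right, lt_top_iff_ne_top]

theorem exists_pos_setLIntegral_enorm_sub_inv_lt {ε : ℝ≥0∞} (hε : ε ≠ 0) :
    ∃ δ > 0, ∀ (z : ℂ) (B : Set ℂ), volume B < δ → ∫⁻ w in B, ‖(w - z)⁻¹‖ₑ < ε := by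
  have hε2 : 0 < ε / 2 := ENNReal.half_pos hε
  obtain ⟨δ, hδ, hlt⟩ := exists_pos_setLIntegral_lt_of_measure_lt
    (setLIntegral_ball_enorm_inv_ne_top 1) hε2.ne'
  refine ⟨min δ (ε / 2), lt_min hδ hε2, fun z B hB => ?_⟩
  rw [← measure_preimage_add_right volume z B, lt_min_iff] at hB
  rw [setLIntegral_enorm_sub_inv, ← ENNReal.add_halves ε]
  refine (setLIntegral_enorm_inv_le _).trans_lt (ENNReal.add_lt_add ?_ hB.2)
  rw [← Measure.restrict_restrict' measurableSet_ball]
  exact hlt _ ((Measure.restrict_apply_le _ _).trans_lt hB.1)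

theorem setLIntegral_enorm_mul_sub_inv_le {g : ℂ → ℂ} {M : ℝ} (hM : ∀ w, ‖g w‖ ≤ M) (z : ℂ)
    (B : Set ℂ) : ∫⁻ w in B, ‖g w * (w - z)⁻¹‖ₑ ≤
      ENNReal.ofReal M * ∫⁻ w in B, ‖(w - z)⁻¹‖ₑ := by
  rw [← lintegral_const_mul' _ _ ENNReal.ofReal_ne_top]
  refine lintegral_mono fun w => ?_
  rw [enorm_mul, ← ofReal_norm (g w)]
  gcongr
  exact hM w

theorem integrable_mul_sub_inv {g : ℂ → ℂ} (hg : Continuous g) (hs : HasCompactSupport g) (z : ℂ) :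
    Integrable fun w => g w * (w - z)⁻¹ := by
  obtain ⟨M, hM⟩ := hg.bounded_above_of_compact_support hs
  have hsupp : Function.support (fun w => g w * (w - z)⁻¹) ⊆ tsupport g :=
    (Function.support_mul_subset_left g _).trans (subset_tsupport g)
  refine (integrableOn_iff_integrable_of_support_subset hsupp).1
    ⟨(hg.measurable.mul (by fun_prop)).aestronglyMeasurable, ?_⟩
  exact (setLIntegral_enorm_mul_sub_inv_le hM z _).trans_lt (ENNReal.mul_lt_top
    ENNReal.ofReal_lt_top (setLIntegral_enorm_sub_inv_lt_top z hs.isCompact.measure_ne_top))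

theorem exists_pos_norm_setIntegral_mul_sub_inv_lt {g : ℂ → ℂ} {M : ℝ} (hM : ∀ w, ‖g w‖ ≤ M)
    {ε : ℝ} (hε : 0 < ε) :
    ∃ δ > 0, ∀ (z : ℂ) (B : Set ℂ), volume B < δ → ‖∫ w in B, g w * (w - z)⁻¹‖ < ε := by
  have hM0 : 0 ≤ M := (norm_nonneg _).trans (hM 0)
  have hη : 0 < ε / (M + 1) := by positivity
  obtain ⟨δ, hδ, hsmall⟩ :=
    exists_pos_setLIntegral_enorm_sub_inv_lt (ENNReal.ofReal_pos.2 hη).ne'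
  refine ⟨δ, hδ, fun z B hB => ?_⟩
  have hle : ‖∫ w in B, g w * (w - z)⁻¹‖ₑ ≤ ENNReal.ofReal (M * (ε / (M + 1))) := by
    rw [ENNReal.ofReal_mul hM0]
    exact (enorm_integral_le_lintegral_enorm _).trans
      ((setLIntegral_enorm_mul_sub_inv_le hM z B).trans (by gcongr; exact (hsmall z B hB).le))
  rw [← ofReal_norm, ENNReal.ofReal_le_ofReal_iff (by positivity)] at hle
  refine hle.trans_lt ?_
  rw [← mul_div_assoc, div_lt_iff₀ (by positivity)]
  nlinarith

/-- Away from `E` the Cauchy transform is an average of kernels whose poles can be pushed to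
infinity; the contribution of a neighbourhood of `E` is small because `g` vanishes on `E`. -/
theorem exists_polynomial_approx_cauchyTransform {E : Set ℂ} (hE : IsCompact E)
    (hc : IsPreconnected Eᶜ) {g : ℂ → ℂ} (hg : Continuous g) (hs : HasCompactSupport g)
    (h0 : ∀ᵐ w, w ∈ E → g w = 0) {ε : ℝ} (hε : 0 < ε) :
    ∃ p : Polynomial ℂ, ∀ z ∈ E, ‖p.eval z - ∫ w, g w * (w - z)⁻¹‖ < ε := by
  obtain ⟨M, hM⟩ := hg.bounded_above_of_compact_support hs
  obtain ⟨δ, hδ, hsmall⟩ := exists_pos_norm_setIntegral_mul_sub_inv_lt hM (half_pos hε)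
  have hU : MeasurableSet (tsupport g \ E) :=
    (isClosed_tsupport g).measurableSet.diff hE.measurableSet
  obtain ⟨A, hAU, hA, hAδ⟩ := hU.exists_isCompact_sdiff_lt (μ := volume)
    (measure_ne_top_of_subset sdiff_subset hs.isCompact.measure_ne_top) hδ.ne'
  obtain ⟨p, hp⟩ := exists_polynomial_approx_setIntegral hE hc hA
    (fun w hw => (hAU hw).2) hg.continuousOn (half_pos hε)
  refine ⟨p, fun z hz => ?_⟩
  have hsplit : ∫ w, g w * (w - z)⁻¹ = (∫ w in A, g w * (w - z)⁻¹) +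
      ∫ w in (tsupport g \ E) \ A, g w * (w - z)⁻¹ := by
    rw [setIntegral_sdiff hA.measurableSet (integrable_mul_sub_inv hg hs z).integrableOn hAU,
      add_sub_cancel]
    refine (setIntegral_eq_integral_of_ae_compl_eq_zero (h0.mono fun w hw hwU => ?_)).symm
    rcases em (w ∈ E) with hwE | hwE
    · rw [hw hwE, zero_mul]
    · rw [image_eq_zero_of_notMem_tsupport fun hm => hwU ⟨hm, hwE⟩, zero_mul]
  rw [hsplit, ← sub_sub, ← add_halves ε]
  exact (norm_sub_le _ _).trans_lt (add_lt_add (hp z hz) (hsmall z _ hAδ))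

end CauchyTransform

section Cutoff

open scoped Manifold ContDiff

theorem exists_contDiff_cutoff {E : Type*} [NormedAddCommGroup E] [NormedSpace ℝ E]
    [FiniteDimensional ℝ E] {K U : Set E} (hK : IsCompact K) (hU : IsOpen U) (hKU : K ⊆ U)
    (n : ℕ∞) :
    ∃ χ : E → ℝ, ContDiff ℝ n χ ∧ HasCompactSupport χ ∧ tsupport χ ⊆ U ∧
      (∀ᶠ w in 𝓝ˢ K, χ w = 1) ∧ ∀ w, χ w ∈ Icc 0 1 := by
  obtain ⟨L, hL, hKL, hLU⟩ := exists_compact_between hK hU hKU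
  obtain ⟨f, hf1, hf0, hf⟩ :=
    exists_contMDiffMap_one_nhds_of_subset_interior 𝓘(ℝ, E) (n := n) hK.isClosed hKL
  have hsub : tsupport f ⊆ L :=
    closure_minimal (fun w hw => not_not.1 fun hwL => hw (hf0 w hwL)) hL.isClosed
  exact ⟨f, f.contMDiff.contDiff, hL.of_isClosed_subset (isClosed_tsupport _) hsub,
    hsub.trans hLU, hf1, hf⟩

theorem contDiff_smul_of_differentiableOn {E : Type*} [NormedAddCommGroup E] [NormedSpace ℂ E]
    [CompleteSpace E] {χ : ℂ → ℝ} {f : ℂ → E} {U : Set ℂ} {n : ℕ∞} (hχ : ContDiff ℝ n χ)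
    (hU : IsOpen U) (hχU : tsupport χ ⊆ U) (hf : DifferentiableOn ℂ f U) :
    ContDiff ℝ n fun w => χ w • f w := by
  refine contDiff_iff_contDiffAt.2 fun w => ?_
  by_cases hw : w ∈ U
  · have hfw : ContDiffAt ℂ n f w := (hf.analyticAt (hU.mem_nhds hw)).contDiffAt
    exact hχ.contDiffAt.smul (hfw.restrict_scalars ℝ)
  · refine (contDiffAt_const (c := 0)).congr_of_eventuallyEq ?_
    filter_upwards [(notMem_tsupport_iff_eventuallyEq (f := χ)).1 fun h => hw (hχU h)] with x hx
    simp [hx]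

end Cutoff

section Runge

theorem exists_polynomial_approx_of_dbar {E : Set ℂ} (hE : IsCompact E) (hc : IsPreconnected Eᶜ)
    {h : ℂ → ℂ} (hh : ContDiff ℝ 1 h) (hs : HasCompactSupport h)
    (h0 : ∀ᵐ w, w ∈ E → dbar h w = 0) {ε : ℝ} (hε : 0 < ε) :
    ∃ p : Polynomial ℂ, ∀ z ∈ E, ‖p.eval z - h z‖ < ε := by
  obtain ⟨p, hp⟩ := exists_polynomial_approx_cauchyTransform hE hc
    (g := fun w => -dbar h w / Real.pi) ((continuous_dbar hh).neg.div_const _)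
    (hs.mono' fun w hw => tsupport_dbar_subset (subset_tsupport _ fun h => hw (by simp [h])))
    (h0.mono fun w hw hwE => by simp [hw hwE]) hε
  refine ⟨p, fun z hz => ?_⟩
  convert hp z hz using 3
  have hpi : (Real.pi : ℂ) ≠ 0 := ofReal_ne_zero.2 Real.pi_ne_zero
  calc h z = -(∫ w, w⁻¹ * dbar h (z + w)) / Real.pi := by
        rw [show ∫ w, w⁻¹ * dbar h (z + w) = _ from integral_inv_smul_dbar hh hs z, neg_neg,
          real_smul, mul_div_cancel_left₀ _ hpi]
    _ = ∫ w, -dbar h w / Real.pi * (w - z)⁻¹ := by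
        rw [← integral_neg, ← integral_div,
          ← integral_add_left_eq_self (fun w => -dbar h w / Real.pi * (w - z)⁻¹) z]
        refine integral_congr_ae (.of_forall fun w => ?_)
        simp only [add_sub_cancel_left]
        ring

theorem exists_polynomial_approx {K U : Set ℂ} (hK : IsCompact K) (hc : IsPreconnected Kᶜ)
    (hU : IsOpen U) (hKU : K ⊆ U) {f : ℂ → ℂ} (hf : DifferentiableOn ℂ f U) {ε : ℝ}
    (hε : 0 < ε) : ∃ p : Polynomial ℂ, ∀ z ∈ K, ‖p.eval z - f z‖ < ε := by
  obtain ⟨χ, hχ, hχs, hχU, hχ1, -⟩ := exists_contDiff_cutoff hK hU hKU 1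
  rw [eventually_nhdsSet_iff_forall] at hχ1
  have heq : ∀ w ∈ K, (fun w => χ w • f w) =ᶠ[𝓝 w] f := fun w hw =>
    (hχ1 w hw).mono fun x hx => by simp only [hx, one_smul]
  obtain ⟨p, hp⟩ := exists_polynomial_approx_of_dbar hK hc
    (contDiff_smul_of_differentiableOn hχ hU hχU hf) hχs.smul_right
    (.of_forall fun w hw => dbar_eq_zero_of_differentiableAt
      ((hf.differentiableAt (hU.mem_nhds (hKU hw))).congr_of_eventuallyEq (heq w hw))) hε
  exact ⟨p, fun z hz => (heq z hz).eq_of_nhds ▸ hp z hz⟩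

end Runge

/-! ### Compact sets that do not separate the plane -/

section PolynomiallyConvex

variable {K : Set ℂ}

theorem hasContLog_polynomial (hK : IsCompact K) (hc : IsPreconnected Kᶜ) {p : Polynomial ℂ}
    (hp : p ≠ 0) (h0 : ∀ z ∈ K, p.eval z ≠ 0) : HasContLog (fun z => p.eval z) K := by
  have hprod : ∀ s : Multiset ℂ, (∀ a ∈ s, a ∉ K) →
      HasContLog (fun z => (s.map fun a => z - a).prod) K := by
    intro s
    induction s using Multiset.induction_on with
    | empty => simpa using hasContLog_const one_ne_zero K
    | cons a s ih =>
      intro hs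
      simp only [Multiset.map_cons, Multiset.prod_cons]
      exact (hasContLog_sub_of_isPreconnected_compl hK hc (hs a (by simp))).mul
        (ih fun b hb => hs b (Multiset.mem_cons_of_mem hb))
  refine ((hasContLog_const (Polynomial.leadingCoeff_ne_zero.2 hp) K).mul
    (hprod p.roots fun a ha haK => ?_)).congr fun z _ => ?_
  · exact h0 a haK (Polynomial.isRoot_of_mem_roots ha)
  · exact ((IsAlgClosed.splits p).eval_eq_prod_roots z).symm

theorem hasContLog_of_differentiableOn {U : Set ℂ} (hK : IsCompact K) (hc : IsPreconnected Kᶜ)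
    (hU : IsOpen U) (hKU : K ⊆ U) {f : ℂ → ℂ} (hf : DifferentiableOn ℂ f U)
    (h0 : ∀ z ∈ K, f z ≠ 0) : HasContLog f K := by
  rcases K.eq_empty_or_nonempty with rfl | hne
  · exact ⟨fun _ => 0, by simp, by simp⟩
  have hfc : ContinuousOn f K := hf.continuousOn.mono hKU
  obtain ⟨z₀, hz₀, hmin⟩ := hK.exists_isMinOn hne hfc.norm
  obtain ⟨p, hp⟩ := exists_polynomial_approx hK hc hU hKU hf (half_pos (norm_pos_iff.2 (h0 z₀ hz₀)))
  have hclose : ∀ z ∈ K, ‖f z - p.eval z‖ < ‖p.eval z‖ := by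
    intro z hz
    have hlow : ‖f z₀‖ ≤ ‖f z‖ := hmin hz
    have hpz := hp z hz
    have htri := norm_sub_norm_le (f z) (p.eval z)
    rw [norm_sub_rev] at hpz
    linarith
  have hp0 : ∀ z ∈ K, p.eval z ≠ 0 := fun z hz =>
    norm_pos_iff.1 ((norm_nonneg _).trans_lt (hclose z hz))
  have hpne : p ≠ 0 := by
    rintro rfl
    exact hp0 z₀ hz₀ (by simp)
  exact (hasContLog_polynomial hK hc hpne hp0).of_norm_sub_lt hfc p.continuous.continuousOn hclose

theorem continuousOn_invFunOn_image {X Y : Type*} [TopologicalSpace X] [Nonempty X]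
    [TopologicalSpace Y] [T2Space Y] {K : Set X} (hK : IsCompact K) {φ : X → Y}
    (hφ : ContinuousOn φ K) (hinj : InjOn φ K) :
    ContinuousOn (Function.invFunOn φ K) (φ '' K) := by
  refine continuousOn_iff_isClosed.2 fun C hC => ⟨φ '' (K ∩ C),
    ((hK.inter_right hC).image_of_continuousOn (hφ.mono inter_subset_left)).isClosed, ?_⟩
  ext y
  constructor
  · rintro ⟨hy, x, hx, rfl⟩
    rw [mem_preimage, hinj.leftInvOn_invFunOn hx] at hy
    exact ⟨mem_image_of_mem φ ⟨hx, hy⟩, mem_image_of_mem φ hx⟩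
  · rintro ⟨⟨x, ⟨hx, hxC⟩, rfl⟩, hy⟩
    refine ⟨?_, hy⟩
    rwa [mem_preimage, hinj.leftInvOn_invFunOn hx]

theorem HasContLog.image {X Y : Type*} [TopologicalSpace X] [TopologicalSpace Y] [T2Space Y]
    {K : Set X} (hK : IsCompact K) {φ : X → Y} (hφ : ContinuousOn φ K) (hinj : InjOn φ K)
    {f : Y → ℂ} (hf : HasContLog (fun x => f (φ x)) K) : HasContLog f (φ '' K) := by
  obtain ⟨h, hc, he⟩ := hf
  rcases K.eq_empty_or_nonempty with rfl | ⟨x₀, -⟩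
  · exact ⟨fun _ => 0, by simp, by simp⟩
  have : Nonempty X := ⟨x₀⟩
  have hinv := hinj.leftInvOn_invFunOn
  refine ⟨fun y => h (Function.invFunOn φ K y),
    hc.comp (continuousOn_invFunOn_image hK hφ hinj) ?_, ?_⟩
  · exact fun y => Function.invFunOn_mem
  · rintro _ ⟨x, hx, rfl⟩
    simp only [hinv hx, he x hx]

theorem isPreconnected_compl_image {U : Set ℂ} (hK : IsCompact K) (hc : IsPreconnected Kᶜ)
    (hU : IsOpen U) (hKU : K ⊆ U) {φ : ℂ → ℂ} (hφ : DifferentiableOn ℂ φ U) (hinj : InjOn φ K) :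
    IsPreconnected (φ '' K)ᶜ := by
  have hφK : ContinuousOn φ K := hφ.continuousOn.mono hKU
  refine isPreconnected_compl_of_hasContLog (hK.image_of_continuousOn hφK) fun a ha => ?_
  exact .image hK hφK hinj (hasContLog_of_differentiableOn hK hc hU hKU (hφ.sub_const a)
    fun z hz h => ha ⟨z, hz, sub_eq_zero.1 h⟩)

theorem hasContLog_sub_of_convex {S : Set ℂ} (hS : Convex ℝ S) (hSc : IsClosed S) {a : ℂ}
    (ha : a ∉ S) : HasContLog (fun w => w - a) S := by
  rcases S.eq_empty_or_nonempty with rfl | ⟨w₀, hw₀⟩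
  · exact ⟨fun _ => 0, by simp, by simp⟩
  obtain ⟨f, u, hfS, hfa⟩ := RCLike.geometric_hahn_banach_closed_point (𝕜 := ℂ) hS hSc ha
  have hf1 : ∀ w, f w = w * f 1 := fun w => by rw [← smul_eq_mul, ← map_smul, smul_eq_mul, mul_one]
  have hlog : HasContLog (fun w => f (a - w)) S := by
    refine hasContLog_of_mem_slitPlane (by fun_prop) fun w hw => Or.inl ?_
    rw [map_sub, sub_re]
    exact sub_pos.2 ((hfS w hw).trans hfa)
  have hf0 : f 1 ≠ 0 := fun h0 => by
    have hlt := (hfS w₀ hw₀).trans hfa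
    rw [hf1, hf1 a, h0, mul_zero, mul_zero] at hlt
    exact hlt.false
  refine (hlog.mul (hasContLog_const (neg_ne_zero.2 (inv_ne_zero hf0)) S)).congr fun w _ => ?_
  beta_reduce
  rw [hf1 (a - w)]
  field_simp
  ring

theorem HasContLog.union_of_inter_subset_singleton {X : Type*} [TopologicalSpace X] {f : X → ℂ}
    {K T : Set X} {k : X} (hK : IsClosed K) (hT : IsClosed T) (hKT : K ∩ T ⊆ {k}) (hkK : k ∈ K)
    (hkT : k ∈ T) (hfK : HasContLog f K) (hfT : HasContLog f T) : HasContLog f (K ∪ T) := by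
  classical
  obtain ⟨u, huc, hu⟩ := hfK
  obtain ⟨v, hvc, hv⟩ := hfT
  have hexp : ∀ z ∈ T, exp (v z + (u k - v k)) = f z := fun z hz => by
    rw [exp_add, exp_sub, hu k hkK, hv z hz, hv k hkT, div_self, mul_one]
    exact hv k hkT ▸ exp_ne_zero _
  have hEqK : EqOn (K.piecewise u fun z => v z + (u k - v k)) u K := piecewise_eqOn _ _ _
  have hEqT : EqOn (K.piecewise u fun z => v z + (u k - v k)) (fun z => v z + (u k - v k)) T := by
    intro z hz
    by_cases hzK : z ∈ K
    · obtain rfl : z = k := hKT ⟨hzK, hz⟩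
      simp [hzK]
    · simp [hzK]
  refine ⟨_, (huc.congr hEqK).union_of_isClosed ((hvc.add continuousOn_const).congr hEqT) hK hT, ?_⟩
  rintro z (hz | hz)
  · rw [hEqK hz, hu z hz]
  · rw [hEqT hz, hexp z hz]

theorem isCompact_segment {E : Type*} [AddCommGroup E] [Module ℝ E] [TopologicalSpace E]
    [IsTopologicalAddGroup E] [ContinuousSMul ℝ E] (x y : E) : IsCompact (segment ℝ x y) := by
  rw [segment_eq_image_lineMap]
  exact isCompact_Icc.image (by fun_prop)

end PolynomiallyConvex

section BridgeComplement

theorem eq_left_of_mem_segment_of_forall_dist_le {E : Type*} [NormedAddCommGroup E]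
    [NormedSpace ℝ E] {K : Set E} {k l x : E} (hmin : ∀ y ∈ K, dist k l ≤ dist y l)
    (hx : x ∈ segment ℝ k l) (hxK : x ∈ K) : x = k := by
  have hadd := dist_add_dist_of_mem_segment hx
  exact (dist_le_zero.1 (by linarith [hmin x hxK])).symm

theorem isPreconnected_compl_bridge {K L : Set ℂ} (hK : IsCompact K) (hL : IsCompact L)
    (hKc : IsPreconnected Kᶜ) (hLc : IsPreconnected Lᶜ) (hKL : Disjoint K L) {k l : ℂ}
    (hk : k ∈ K) (hl : l ∈ L) (hmin : ∀ x ∈ K, ∀ y ∈ L, dist k l ≤ dist x y) :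
    IsPreconnected (K ∪ segment ℝ k l ∪ L)ᶜ := by
  have hS := isCompact_segment k l
  refine isPreconnected_compl_of_hasContLog ((hK.union hS).union hL) fun a ha => ?_
  simp only [mem_union, not_or] at ha
  refine .union_of_inter_subset_singleton (hK.union hS).isClosed hL.isClosed (k := l) ?_
    (Or.inr (right_mem_segment ℝ k l)) hl (.union_of_inter_subset_singleton hK.isClosed
      hS.isClosed (k := k) ?_ hk (left_mem_segment ℝ k l)
      (hasContLog_sub_of_isPreconnected_compl hK hKc ha.1.1)
      (hasContLog_sub_of_convex (convex_segment k l) hS.isClosed ha.1.2))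
    (hasContLog_sub_of_isPreconnected_compl hL hLc ha.2)
  · rintro x ⟨hx | hx, hxL⟩
    · exact (disjoint_left.1 hKL hx hxL).elim
    · refine eq_left_of_mem_segment_of_forall_dist_le (l := k) (fun y hy => ?_)
        (segment_symm ℝ k l ▸ hx) hxL
      simpa only [dist_comm] using hmin k hk y hy
  · rintro x ⟨hxK, hx⟩
    exact eq_left_of_mem_segment_of_forall_dist_le (fun y hy => hmin y hy l hl) hx hxK

end BridgeComplement

/-! ### Entire functions with prescribed derivatives along a bridge -/

section Bridge

theorem exists_shrinking_cutoffs {E : Type*} [NormedAddCommGroup E] [NormedSpace ℝ E]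
    [FiniteDimensional ℝ E] {K U : Set E} (hK : IsCompact K) (hU : IsOpen U) (hKU : K ⊆ U)
    (m : ℕ∞) :
    ∃ χ : ℕ → E → ℝ, (∀ n, ContDiff ℝ m (χ n)) ∧ (∀ n, HasCompactSupport (χ n)) ∧
      (∀ n, tsupport (χ n) ⊆ U) ∧ (∀ n, ∀ᶠ w in 𝓝ˢ K, χ n w = 1) ∧
      (∀ n w, χ n w ∈ Icc 0 1) ∧ ∀ w ∉ K, ∀ᶠ n in atTop, χ n w = 0 := by
  have hpos : ∀ n : ℕ, (0 : ℝ) < 1 / (n + 1) := fun n => Nat.one_div_pos_of_nat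
  choose χ h1 h2 h3 h4 h5 using fun n : ℕ => exists_contDiff_cutoff hK
    (hU.inter (Metric.isOpen_thickening (δ := 1 / ((n : ℝ) + 1)) (E := K)))
    (subset_inter hKU (Metric.self_subset_thickening (hpos n) K)) m
  refine ⟨χ, h1, h2, fun n => (h3 n).trans inter_subset_left, h4, h5, fun w hw => ?_⟩
  have hd : 0 < Metric.infEDist w K :=
    pos_iff_ne_zero.2 fun h => hw ((Metric.mem_iff_infEDist_zero_of_closed hK.isClosed).2 h)
  have hlim : Tendsto (fun n : ℕ => ENNReal.ofReal (1 / ((n : ℝ) + 1))) atTop (𝓝 0) := by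
    simpa using ENNReal.tendsto_ofReal tendsto_one_div_add_atTop_nhds_zero_nat
  filter_upwards [hlim.eventually (gt_mem_nhds hd)] with n hn
  exact image_eq_zero_of_notMem_tsupport fun h => hn.not_gt (h3 n h).2

theorem addHaar_segment_eq_zero {E : Type*} [NormedAddCommGroup E] [NormedSpace ℝ E]
    [MeasurableSpace E] [BorelSpace E] [FiniteDimensional ℝ E] (hE : 1 < Module.finrank ℝ E)
    (μ : Measure E) [μ.IsAddHaarMeasure] (x y : E) : μ (segment ℝ x y) = 0 := by
  have hspan : affineSpan ℝ {x, y} ≠ ⊤ := by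
    intro htop
    have hle := collinear_iff_finrank_le_one.1 (collinear_pair ℝ x y)
    rw [← direction_affineSpan, htop, AffineSubspace.direction_top, finrank_top] at hle
    exact hE.not_ge hle
  refine measure_mono_null ?_ (Measure.addHaar_affineSubspace μ _ hspan)
  rw [← convexHull_pair]
  exact convexHull_subset_affineSpan _

theorem exists_shrinking_extensions {E : Type*} [NormedAddCommGroup E] [NormedSpace ℂ E]
    [CompleteSpace E] {K U : Set ℂ} (hK : IsCompact K) (hU : IsOpen U) (hKU : K ⊆ U) {f : ℂ → E}
    (hf : DifferentiableOn ℂ f U) (m : ℕ∞) :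
    ∃ h : ℕ → ℂ → E, (∀ n, ContDiff ℝ m (h n)) ∧ (∀ n, HasCompactSupport (h n)) ∧
      (∀ n, ∀ᶠ w in 𝓝ˢ K, h n w = f w) ∧ (∃ M, ∀ n w, ‖h n w‖ ≤ M) ∧
      ∀ w ∉ K, ∀ᶠ n in atTop, h n w = 0 := by
  obtain ⟨V, hV, hKV, hVU, hVc⟩ := exists_open_between_and_isCompact_closure hK hU hKU
  obtain ⟨B, hB⟩ := hVc.exists_bound_of_continuousOn (hf.continuousOn.mono hVU)
  obtain ⟨χ, hχ, hχc, hχV, hχ1, hχI, hχ0⟩ := exists_shrinking_cutoffs hK hV hKV m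
  refine ⟨fun n w => χ n w • f w, fun n => contDiff_smul_of_differentiableOn (hχ n) hU
    ((hχV n).trans (subset_closure.trans hVU)) hf, fun n => (hχc n).smul_right, fun n => ?_,
    ⟨B ⊔ 0, fun n w => ?_⟩, fun w hw => ?_⟩
  · filter_upwards [hχ1 n] with w hw
    rw [hw, one_smul]
  · by_cases hwV : w ∈ V
    · rw [norm_smul, Real.norm_of_nonneg (hχI n w).1]
      exact (mul_le_of_le_one_left (norm_nonneg _) (hχI n w).2).trans
        ((hB w (subset_closure hwV)).trans le_sup_left)
    · simp only [image_eq_zero_of_notMem_tsupport fun h => hwV (hχV n h), zero_smul, norm_zero]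
      exact le_sup_right
  · filter_upwards [hχ0 w hw] with n hn
    rw [hn, zero_smul]

-- Extend `f - c` to `h n` supported near `K`, ever closer as `n` grows: the polynomials
-- approximating `h n` do not notice that `h n` fails to be holomorphic on the null set `S`.
theorem exists_seq_polynomial_approx_union_null {K S U : Set ℂ} (hK : IsCompact K)
    (hS : IsCompact S) (hc : IsPreconnected (K ∪ S)ᶜ) (hS0 : volume S = 0) (hU : IsOpen U)
    (hKU : K ⊆ U) {f : ℂ → ℂ} (hf : DifferentiableOn ℂ f U) (c : ℂ) :
    ∃ P : ℕ → Polynomial ℂ, TendstoUniformlyOn (fun n z => (P n).eval z) f atTop K ∧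
      (∃ M, ∀ n, ∀ z ∈ S, ‖(P n).eval z‖ ≤ M) ∧
      ∀ z ∈ S, z ∉ K → Tendsto (fun n => (P n).eval z) atTop (𝓝 c) := by
  obtain ⟨h, hh, hhc, hhK, ⟨B, hB⟩, hh0⟩ :=
    exists_shrinking_extensions hK hU hKU (hf.sub_const c) 1
  have hdbar n : ∀ᵐ w, w ∈ K ∪ S → dbar (h n) w = 0 := by
    filter_upwards [measure_eq_zero_iff_ae_notMem.1 hS0] with w hwS hw
    have hwK : w ∈ K := hw.resolve_right hwS
    exact dbar_eq_zero_of_differentiableAt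
      (((hf.sub_const c).differentiableAt (hU.mem_nhds (hKU hwK))).congr_of_eventuallyEq
        (eventually_nhdsSet_iff_forall.1 (hhK n) w hwK))
  choose P hP using fun n : ℕ => exists_polynomial_approx_of_dbar (hK.union hS) hc (hh n) (hhc n)
    (hdbar n) (Nat.one_div_pos_of_nat (α := ℝ) (n := n))
  have hlim := tendsto_one_div_add_atTop_nhds_zero_nat (𝕜 := ℝ)
  refine ⟨fun n => P n + .C c, ?_, ⟨1 + B + ‖c‖, fun n z hz => ?_⟩, fun z hz hzK => ?_⟩
  · refine Metric.tendstoUniformlyOn_iff.2 fun ε hε => ?_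
    filter_upwards [hlim.eventually (gt_mem_nhds hε)] with n hn z hz
    have hPz := hP n z (Or.inl hz)
    rw [(hhK n).self_of_nhdsSet z hz] at hPz
    rw [dist_comm, dist_eq_norm, Polynomial.eval_add, Polynomial.eval_C, ← sub_sub_eq_add_sub]
    exact hPz.trans hn
  · have hPz : ‖(P n).eval z - h n z‖ ≤ 1 := (hP n z (Or.inr hz)).le.trans
      (by simpa using Nat.one_div_le_one_div (α := ℝ) n.zero_le)
    rw [Polynomial.eval_add, Polynomial.eval_C]
    linarith [norm_add_le ((P n).eval z) c, norm_sub_norm_le ((P n).eval z) (h n z), hB n z]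
  · have hP0 : Tendsto (fun n => (P n).eval z) atTop (𝓝 0) := by
      refine squeeze_zero_norm' ?_ hlim
      filter_upwards [hh0 z hzK] with n hn
      simpa only [hn, sub_zero] using (hP n z (Or.inr hz)).le
    simpa using hP0.add_const c

theorem tendsto_sub_of_hasDerivAt_exp {G p : ℕ → ℂ → ℂ} (hp : ∀ n, Continuous (p n))
    (hG : ∀ n z, HasDerivAt (G n) (exp (p n z)) z) {k l c : ℂ} {M : ℝ}
    (hM : ∀ n, ∀ z ∈ segment ℝ k l, ‖p n z‖ ≤ M)
    (hc : ∀ z ∈ openSegment ℝ k l, Tendsto (fun n => p n z) atTop (𝓝 c)) :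
    Tendsto (fun n => G n l - G n k) atTop (𝓝 ((l - k) * exp c)) := by
  have hFTC n : G n l - G n k = (l - k) * ∫ t : ℝ in 0..1, exp (p n (k + t • (l - k))) := by
    have := intervalIntegral.integral_unitInterval_deriv_eq_sub (z₀ := k) (z₁ := l - k)
      (f := G n) (f' := fun z => exp (p n z))
      (by have := hp n; fun_prop) fun t _ => hG n _
    rw [← smul_eq_mul, this, add_sub_cancel]
  have hexp : Tendsto (fun n => ∫ t : ℝ in 0..1, exp (p n (k + t • (l - k)))) atTop
      (𝓝 (∫ _ in (0 : ℝ)..1, exp c)) := by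
    refine intervalIntegral.tendsto_integral_filter_of_dominated_convergence
      (fun _ => Real.exp M) (.of_forall fun n => ?_)
      (.of_forall fun n => .of_forall fun t ht => ?_) (by simp) ?_
    · have := hp n
      exact Continuous.aestronglyMeasurable (by fun_prop)
    · rw [uIoc_of_le zero_le_one] at ht
      refine (norm_exp_le_exp_norm _).trans (Real.exp_le_exp.2 (hM n _ ?_))
      exact segment_eq_image' ℝ k l ▸ mem_image_of_mem _ (Ioc_subset_Icc_self ht)
    · filter_upwards [Measure.ae_ne volume (1 : ℝ)] with t ht1 ht
      rw [uIoc_of_le zero_le_one] at ht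
      refine (continuous_exp.tendsto c).comp (hc _ ?_)
      exact openSegment_eq_image' ℝ k l ▸ mem_image_of_mem _ ⟨ht.1, ht.2.lt_of_ne ht1⟩
  simp only [hFTC]
  simpa using hexp.const_mul (l - k)

theorem exists_differentiableOn_of_disjoint {E : Type*} [NormedAddCommGroup E] [NormedSpace ℂ E]
    {K L U V : Set ℂ} (hK : IsCompact K) (hL : IsCompact L) (hKL : Disjoint K L) (hU : IsOpen U)
    (hKU : K ⊆ U) (hV : IsOpen V) (hLV : L ⊆ V) {a b : ℂ → E} (ha : DifferentiableOn ℂ a U)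
    (hb : DifferentiableOn ℂ b V) :
    ∃ W : Set ℂ, ∃ f : ℂ → E, IsOpen W ∧ K ∪ L ⊆ W ∧ DifferentiableOn ℂ f W ∧ EqOn f a K ∧
      EqOn f b L := by
  classical
  obtain ⟨U', V', hU', hV', hKU', hLV', hUV'⟩ := SeparatedNhds.of_isCompact_isCompact hK hL hKL
  have hfU : EqOn (U'.piecewise a b) a U' := piecewise_eqOn _ _ _
  have hfV : EqOn (U'.piecewise a b) b V' := fun z hz =>
    piecewise_eq_of_notMem _ _ _ (disjoint_right.1 hUV' hz)
  exact ⟨U ∩ U' ∪ V ∩ V', U'.piecewise a b, (hU.inter hU').union (hV.inter hV'),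
    union_subset_union (subset_inter hKU hKU') (subset_inter hLV hLV'),
    ((ha.mono inter_subset_left).congr (hfU.mono inter_subset_right)).union_of_isOpen
      ((hb.mono inter_subset_left).congr (hfV.mono inter_subset_right))
      (hU.inter hU') (hV.inter hV'), hfU.mono hKU', hfV.mono hLV'⟩

-- On the segment, prescribe the constant `c` for which `exp c` has the integral `β - α`.
theorem exists_seq_entire_bridge {K L U : Set ℂ} (hK : IsCompact K) (hL : IsCompact L)
    (hKc : IsPreconnected Kᶜ) (hLc : IsPreconnected Lᶜ) (hKL : Disjoint K L) {k l : ℂ}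
    (hk : k ∈ K) (hl : l ∈ L) (hmin : ∀ x ∈ K, ∀ y ∈ L, dist k l ≤ dist x y) (hU : IsOpen U)
    (hKLU : K ∪ L ⊆ U) {f : ℂ → ℂ} (hf : DifferentiableOn ℂ f U) {α β : ℂ} (hαβ : α ≠ β) :
    ∃ G : ℕ → ℂ → ℂ, (∀ n, Differentiable ℂ (G n)) ∧ (∀ n z, deriv (G n) z ≠ 0) ∧
      TendstoUniformlyOn (fun n => deriv (G n)) (exp ∘ f) atTop (K ∪ L) ∧
      (∀ n, G n k = α) ∧ Tendsto (fun n => G n l) atTop (𝓝 β) := by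
  have hkl : k ≠ l := fun h => disjoint_left.1 hKL hk (h ▸ hl)
  have hlk : l - k ≠ 0 := sub_ne_zero.2 hkl.symm
  obtain ⟨c, hc⟩ : ∃ c, exp c = (β - α) / (l - k) :=
    ⟨_, exp_log (div_ne_zero (sub_ne_zero.2 hαβ.symm) hlk)⟩
  obtain ⟨P, hPf, ⟨M, hM⟩, hPc⟩ := exists_seq_polynomial_approx_union_null (hK.union hL)
    (isCompact_segment k l)
    (union_right_comm K L _ ▸ isPreconnected_compl_bridge hK hL hKc hLc hKL hk hl hmin)
    (addHaar_segment_eq_zero (by simp) volume k l) hU hKLU hf c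
  choose G hGk hG using fun n => (Differentiable.isExactOn_univ (f := fun z => exp ((P n).eval z))
    (P n).differentiable.cexp).with_val_at k α
  have hGd n z : HasDerivAt (G n) (exp ((P n).eval z)) z := hG n z (mem_univ z)
  have hGderiv n : deriv (G n) = exp ∘ fun z => (P n).eval z := funext fun z => (hGd n z).deriv
  refine ⟨G, fun n z => (hGd n z).differentiableAt, fun n z => hGderiv n ▸ exp_ne_zero _, ?_,
    hGk, ?_⟩
  · simp only [hGderiv]
    refine hPf.comp_cexp ((hK.union hL).image_of_continuousOn ?_).bddAbove
    exact continuous_re.comp_continuousOn (hf.continuousOn.mono hKLU)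
  · have hnot : ∀ z ∈ openSegment ℝ k l, z ∉ K ∪ L := by
      rintro z hz (hzK | hzL)
      · obtain rfl := eq_left_of_mem_segment_of_forall_dist_le (fun y hy => hmin y hy l hl)
          (openSegment_subset_segment ℝ k l hz) hzK
        exact hkl (left_mem_openSegment_iff.1 hz)
      · obtain rfl := eq_left_of_mem_segment_of_forall_dist_le (k := l) (l := k)
          (fun y hy => by simpa only [dist_comm] using hmin k hk y hy)
          (segment_symm ℝ k l ▸ openSegment_subset_segment ℝ k l hz) hzL
        exact hkl (right_mem_openSegment_iff.1 hz)
    have hlim := tendsto_sub_of_hasDerivAt_exp (fun n => (P n).continuous) hGd hM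
      fun z hz => hPc z (openSegment_subset_segment ℝ k l hz) (hnot z hz)
    simpa only [hGk, hc, mul_div_cancel₀ _ hlk, sub_add_cancel] using hlim.add_const α

end Bridge

/-! ### Simultaneous approximation of functions and their compositions -/

section Oscillation

/-- On `T`, the oscillation of a holomorphic function on `Ω` is controlled by the size of its
derivative; this allows one to pass from approximation of derivatives on `T` to approximation of
functions on `T`. -/
def HasOscBound (Ω T : Set ℂ) : Prop :=
  ∃ C : ℝ, ∀ (F : ℂ → ℂ) (M : ℝ), DifferentiableOn ℂ F Ω → (∀ z ∈ T, ‖deriv F z‖ ≤ M) →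
    ∀ z ∈ T, ∀ w ∈ T, ‖F z - F w‖ ≤ C * M

variable {Ω T T' : Set ℂ}

theorem hasOscBound_of_convex (hΩ : IsOpen Ω) (hTΩ : T ⊆ Ω) (hT : Convex ℝ T)
    (hTb : Bornology.IsBounded T) : HasOscBound Ω T := by
  refine ⟨Metric.diam T, fun F M hF hM z hz w hw => ?_⟩
  have hM0 : 0 ≤ M := (norm_nonneg _).trans (hM z hz)
  calc ‖F z - F w‖ ≤ M * ‖z - w‖ := hT.norm_image_sub_le_of_norm_deriv_le
        (fun x hx => hF.differentiableAt (hΩ.mem_nhds (hTΩ hx))) hM hw hz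
    _ ≤ M * Metric.diam T := by
        rw [← dist_eq_norm]
        gcongr
        exact Metric.dist_le_diam_of_mem hTb hz hw
    _ = Metric.diam T * M := mul_comm _ _

theorem HasOscBound.union (hT : HasOscBound Ω T) (hT' : HasOscBound Ω T')
    (hne : (T ∩ T').Nonempty) : HasOscBound Ω (T ∪ T') := by
  obtain ⟨C, hC⟩ := hT
  obtain ⟨C', hC'⟩ := hT'
  obtain ⟨y, hyT, hyT'⟩ := hne
  refine ⟨C + C', fun F M hF hM z hz w hw => ?_⟩
  have hFT := hC F M hF fun x hx => hM x (Or.inl hx)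
  have hFT' := hC' F M hF fun x hx => hM x (Or.inr hx)
  have hCM : 0 ≤ C * M := (norm_nonneg _).trans (hFT y hyT y hyT)
  have hCM' : 0 ≤ C' * M := (norm_nonneg _).trans (hFT' y hyT' y hyT')
  have htri := norm_sub_le_norm_sub_add_norm_sub (F z) (F y) (F w)
  rw [add_mul]
  rcases hz with hz | hz <;> rcases hw with hw | hw
  · linarith [hFT z hz w hw]
  · linarith [hFT z hz y hyT, hFT' y hyT' w hw]
  · linarith [hFT' z hz y hyT', hFT y hyT w hw]
  · linarith [hFT' z hz w hw]

theorem HasOscBound.fill (hT : HasOscBound Ω T) (hTc : IsCompact T) (hTΩ : fill T ⊆ Ω) :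
    HasOscBound Ω (fill T) := by
  obtain ⟨C, hC⟩ := hT
  have hfill : IsCompact (LocUniv.fill T) := isCompact_fill (by simp) hTc
  have hmax : ∀ F : ℂ → ℂ, DifferentiableOn ℂ F Ω → ∀ B c, (∀ z ∈ T, ‖F z - c‖ ≤ B) →
      ∀ z ∈ LocUniv.fill T, ‖F z - c‖ ≤ B := fun F hF B c hB z hz =>
    norm_le_of_forall_mem_frontier_norm_le hfill.isBounded
      (DifferentiableOn.diffContOnCl (hfill.isClosed.closure_eq.symm ▸ (hF.mono hTΩ).sub_const c))
      (fun w hw => hB w (frontier_fill_subset hTc.isClosed hw)) (subset_closure hz)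
  refine ⟨C, fun F M hF hM z hz w hw => hmax F hF _ _ (fun x hx => ?_) z hz⟩
  rw [norm_sub_rev]
  exact hmax F hF _ _ (fun y hy => hC F M hF (fun t ht => hM t (subset_fill T ht)) y hy x hx) w hw

theorem exists_closedBall_hasOscBound (hΩ : IsOpen Ω) {z : ℂ} (hz : z ∈ Ω) :
    ∃ r > 0, Metric.closedBall z r ⊆ Ω ∧ HasOscBound Ω (Metric.closedBall z r) := by
  obtain ⟨r, hr, hrΩ⟩ := Metric.nhds_basis_closedBall.mem_iff.1 (hΩ.mem_nhds hz)
  exact ⟨r, hr, hrΩ, hasOscBound_of_convex hΩ hrΩ (convex_closedBall z r)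
    (Metric.isBounded_closedBall (x := z) (r := r))⟩

theorem exists_isCompact_hasOscBound (hΩ : IsOpen Ω) (hc : IsPreconnected Ω) {z w : ℂ} (hz : z ∈ Ω)
    (hw : w ∈ Ω) : ∃ T, IsCompact T ∧ T ⊆ Ω ∧ HasOscBound Ω T ∧ z ∈ T ∧ w ∈ T := by
  refine hc.induction₂ (fun x y => ∃ T, IsCompact T ∧ T ⊆ Ω ∧ HasOscBound Ω T ∧ x ∈ T ∧ y ∈ T)
    (fun x hx => ?_) ?_ ?_ hz hw
  · obtain ⟨r, hr, hrΩ, hball⟩ := exists_closedBall_hasOscBound hΩ hx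
    filter_upwards [mem_nhdsWithin_of_mem_nhds (Metric.closedBall_mem_nhds x hr)] with y hy
    exact ⟨_, isCompact_closedBall x r, hrΩ, hball, Metric.mem_closedBall_self hr.le, hy⟩
  · rintro x y v - - - ⟨T, hT, hTΩ, hosc, hx, hy⟩ ⟨T', hT', hTΩ', hosc', hy', hv⟩
    exact ⟨T ∪ T', hT.union hT', union_subset hTΩ hTΩ', hosc.union hosc' ⟨y, hy, hy'⟩,
      Or.inl hx, Or.inr hv⟩
  · rintro x y - - ⟨T, hT, hTΩ, hosc, hx, hy⟩
    exact ⟨T, hT, hTΩ, hosc, hy, hx⟩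

theorem exists_isCompact_hasOscBound_superset (hΩ : IsOpen Ω) (hc : IsConnected Ω) {K : Set ℂ}
    (hK : IsCompact K) (hKΩ : K ⊆ Ω) :
    ∃ T, IsCompact T ∧ T ⊆ Ω ∧ HasOscBound Ω T ∧ T.Nonempty ∧ K ⊆ T := by
  obtain ⟨z, hz⟩ := hc.nonempty
  suffices ∃ T, IsCompact T ∧ T ⊆ Ω ∧ HasOscBound Ω T ∧ z ∈ T ∧ K ⊆ T by
    obtain ⟨T, hT, hTΩ, hosc, hzT, hKT⟩ := this
    exact ⟨T, hT, hTΩ, hosc, ⟨z, hzT⟩, hKT⟩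
  refine hK.induction_on
    (p := fun S => ∃ T, IsCompact T ∧ T ⊆ Ω ∧ HasOscBound Ω T ∧ z ∈ T ∧ S ⊆ T) ?_ ?_ ?_ ?_
  · obtain ⟨T, hT, hTΩ, hosc, hzT, -⟩ := exists_isCompact_hasOscBound hΩ hc.isPreconnected hz hz
    exact ⟨T, hT, hTΩ, hosc, hzT, empty_subset T⟩
  · rintro S S' hSS' ⟨T, hT, hTΩ, hosc, hzT, hST⟩
    exact ⟨T, hT, hTΩ, hosc, hzT, hSS'.trans hST⟩
  · rintro S S' ⟨T, hT, hTΩ, hosc, hzT, hST⟩ ⟨T', hT', hTΩ', hosc', hzT', hST'⟩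
    exact ⟨T ∪ T', hT.union hT', union_subset hTΩ hTΩ', hosc.union hosc' ⟨z, hzT, hzT'⟩,
      Or.inl hzT, union_subset_union hST hST'⟩
  · intro x hx
    obtain ⟨T, hT, hTΩ, hosc, hzT, hxT⟩ :=
      exists_isCompact_hasOscBound hΩ hc.isPreconnected hz (hKΩ hx)
    obtain ⟨r, hr, hrΩ, hball⟩ := exists_closedBall_hasOscBound hΩ (hKΩ hx)
    exact ⟨_, mem_nhdsWithin_of_mem_nhds (Metric.closedBall_mem_nhds x hr),
      T ∪ Metric.closedBall x r, hT.union (isCompact_closedBall x r), union_subset hTΩ hrΩ,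
      hosc.union hball ⟨x, hxT, Metric.mem_closedBall_self hr.le⟩, Or.inl hzT, subset_union_right⟩

theorem HasOscBound.tendstoUniformlyOn (hT : HasOscBound Ω T) (hΩ : IsOpen Ω) (hTΩ : T ⊆ Ω)
    {ι : Type*} {p : Filter ι} {F : ι → ℂ → ℂ} {f : ℂ → ℂ} (hF : ∀ i, DifferentiableOn ℂ (F i) Ω)
    (hf : DifferentiableOn ℂ f Ω)
    (hderiv : TendstoUniformlyOn (fun i => deriv (F i)) (deriv f) p T) {k : ℂ} (hk : k ∈ T)
    (hFk : Tendsto (fun i => F i k) p (𝓝 (f k))) : TendstoUniformlyOn F f p T := by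
  obtain ⟨C, hC⟩ := hT
  rw [Metric.tendstoUniformlyOn_iff] at hderiv ⊢
  intro ε hε
  set η := ε / 2 / (|C| + 1)
  filter_upwards [hderiv η (by positivity), Metric.tendsto_nhds.1 hFk (ε / 2) (half_pos hε)]
    with i hi hik z hz
  have hosc : ‖(f z - F i z) - (f k - F i k)‖ ≤ C * η := by
    refine hC (fun w => f w - F i w) η (hf.sub (hF i)) (fun w hw => ?_) z hz k hk
    have hwΩ := hΩ.mem_nhds (hTΩ hw)
    rw [deriv_fun_sub (hf.differentiableAt hwΩ) ((hF i).differentiableAt hwΩ), ← dist_eq_norm]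
    exact (hi w hw).le
  have hCη : C * η ≤ ε / 2 := by
    rw [← mul_div_assoc, div_le_iff₀ (by positivity), mul_comm]
    gcongr
    exact (le_abs_self C).trans (lt_add_one _).le
  rw [dist_comm, dist_eq_norm] at hik
  rw [dist_eq_norm]
  linarith [norm_le_norm_add_norm_sub' (f z - F i z) (f k - F i k)]

theorem exists_isCompact_hasOscBound_isPreconnected_compl (hΩ : IsOpen Ω) (hc : IsSimplyConnected Ω)
    {K : Set ℂ} (hK : IsCompact K) (hKΩ : K ⊆ Ω) :
    ∃ T, IsCompact T ∧ T ⊆ Ω ∧ HasOscBound Ω T ∧ T.Nonempty ∧ IsPreconnected Tᶜ ∧ K ⊆ T := by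
  obtain ⟨T, hT, hTΩ, hosc, hne, hKT⟩ := exists_isCompact_hasOscBound_superset hΩ
    hc.isPathConnected.isConnected hK hKΩ
  have hfillΩ := fill_subset_of_isSimplyConnected hc hΩ hT.isClosed hTΩ
  exact ⟨fill T, isCompact_fill (by simp) hT, hfillΩ, hosc.fill hT hfillΩ, hne.mono (subset_fill T),
    isPreconnected_compl_fill (by simp) hT.isBounded, hKT.trans (subset_fill T)⟩

end Oscillation

section Composition

theorem isOpen_image_of_deriv_ne_zero {𝕜 : Type*} [RCLike 𝕜] {U : Set 𝕜} (hU : IsOpen U)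
    {φ : 𝕜 → 𝕜} (hφ : ContDiffOn 𝕜 1 φ U) (h0 : ∀ z ∈ U, deriv φ z ≠ 0) : IsOpen (φ '' U) := by
  rw [isOpen_iff_mem_nhds]
  rintro _ ⟨z, hz, rfl⟩
  rw [← ((hφ.contDiffAt (hU.mem_nhds hz)).hasStrictDerivAt one_ne_zero).map_nhds_eq (h0 z hz)]
  exact image_mem_map (hU.mem_nhds hz)

theorem differentiableOn_invFunOn_image {𝕜 : Type*} [RCLike 𝕜] {U : Set 𝕜} (hU : IsOpen U)
    {φ : 𝕜 → 𝕜} (hφ : ContDiffOn 𝕜 1 φ U) (h0 : ∀ z ∈ U, deriv φ z ≠ 0) (hinj : InjOn φ U) :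
    DifferentiableOn 𝕜 (Function.invFunOn φ U) (φ '' U) := by
  rintro _ ⟨z, hz, rfl⟩
  have hst := (hφ.contDiffAt (hU.mem_nhds hz)).hasStrictDerivAt one_ne_zero
  refine (hst.to_local_left_inverse (h0 z hz) ?_).hasDerivAt.differentiableAt.differentiableWithinAt
  filter_upwards [hU.mem_nhds hz] with x hx using hinj.leftInvOn_invFunOn hx

theorem tendstoUniformlyOn_mul_right {ι X R : Type*} [NonUnitalSeminormedRing R] {F : ι → X → R}
    {f u : X → R} {p : Filter ι} {S : Set X} (hF : TendstoUniformlyOn F f p S) {B : ℝ}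
    (hu : ∀ x ∈ S, ‖u x‖ ≤ B) :
    TendstoUniformlyOn (fun i x => F i x * u x) (fun x => f x * u x) p S := by
  rw [Metric.tendstoUniformlyOn_iff] at hF ⊢
  intro ε hε
  filter_upwards [hF (ε / (|B| + 1)) (by positivity)] with i hi x hx
  have hFx := hi x hx
  rw [dist_eq_norm, lt_div_iff₀ (by positivity)] at hFx
  rw [dist_eq_norm, ← sub_mul]
  calc ‖(f x - F i x) * u x‖ ≤ ‖f x - F i x‖ * ‖u x‖ := norm_mul_le _ _
    _ ≤ ‖f x - F i x‖ * (|B| + 1) := by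
        gcongr
        exact (hu x hx).trans ((le_abs_self B).trans (lt_add_one _).le)
    _ < ε := hFx

theorem tendstoUniformlyOn_deriv_comp {Ω T : Set ℂ} (hΩ : IsOpen Ω) (hT : IsCompact T)
    (hTΩ : T ⊆ Ω) {φ : ℂ → ℂ} (hφ : DifferentiableOn ℂ φ Ω) {ι : Type*} {p : Filter ι}
    {G : ι → ℂ → ℂ} (hG : ∀ i, Differentiable ℂ (G i)) {B : ℂ → ℂ}
    (hB : TendstoUniformlyOn (fun i => deriv (G i)) B p (φ '' T)) :
    TendstoUniformlyOn (fun i => deriv (G i ∘ φ)) (fun z => B (φ z) * deriv φ z) p T := by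
  obtain ⟨N, hN⟩ := hT.exists_bound_of_continuousOn ((hφ.deriv hΩ).continuousOn.mono hTΩ)
  refine (tendstoUniformlyOn_mul_right ((hB.comp φ).mono (subset_preimage_image φ T)) hN).congr
    (.of_forall fun i z hz => ?_)
  exact (deriv_comp z (hG i _) (hφ.differentiableAt (hΩ.mem_nhds (hTΩ hz)))).symm

theorem exists_seq_entire_approx_comp {Ω T U : Set ℂ} (hΩ : IsOpen Ω) (hc : IsSimplyConnected Ω)
    (hT : IsCompact T) (hTc : IsPreconnected Tᶜ) (hosc : HasOscBound Ω T) (hU : IsOpen U)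
    (hTU : T ⊆ U) (hUΩ : U ⊆ Ω) {φ f g : ℂ → ℂ} (hφ : DifferentiableOn ℂ φ Ω)
    (hφ0 : ∀ z ∈ Ω, deriv φ z ≠ 0) (hinj : InjOn φ U) (hdisj : Disjoint T (φ '' T))
    (hf : DifferentiableOn ℂ f Ω) (hf0 : ∀ z ∈ Ω, deriv f z ≠ 0) (hg : DifferentiableOn ℂ g Ω)
    (hg0 : ∀ z ∈ Ω, deriv g z ≠ 0) {k m : ℂ} (hk : k ∈ T) (hm : m ∈ T)
    (hmin : ∀ x ∈ T, ∀ y ∈ T, dist k (φ m) ≤ dist x (φ y)) (hne : f k ≠ g m) :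
    ∃ G : ℕ → ℂ → ℂ, (∀ n, Differentiable ℂ (G n)) ∧ (∀ n z, deriv (G n) z ≠ 0) ∧
      TendstoUniformlyOn G f atTop T ∧ TendstoUniformlyOn (fun n => G n ∘ φ) g atTop T := by
  have hTΩ := hTU.trans hUΩ
  have hφU : ContDiffOn ℂ 1 φ U := (hφ.mono hUΩ).contDiffOn hU
  have hφ0U : ∀ z ∈ U, deriv φ z ≠ 0 := fun z hz => hφ0 z (hUΩ hz)
  have hψ : LeftInvOn (Function.invFunOn φ U) φ U := hinj.leftInvOn_invFunOn
  obtain ⟨a, ha, hea⟩ := exists_differentiableOn_log hc hΩ (hf.deriv hΩ) hf0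
  obtain ⟨b, hb, heb⟩ := exists_differentiableOn_log hc hΩ ((hg.deriv hΩ).div (hφ.deriv hΩ) hφ0)
    fun z hz => div_ne_zero (hg0 z hz) (hφ0 z hz)
  have hbψ : DifferentiableOn ℂ (b ∘ Function.invFunOn φ U) (φ '' U) :=
    hb.comp (differentiableOn_invFunOn_image hU hφU hφ0U hinj)
      fun w hw => hUΩ (Function.invFunOn_mem hw)
  have hφT : IsCompact (φ '' T) := hT.image_of_continuousOn (hφ.continuousOn.mono hTΩ)
  obtain ⟨W, h, hW, hTW, hh, hha, hhb⟩ := exists_differentiableOn_of_disjoint hT hφT hdisj hΩ hTΩ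
    (isOpen_image_of_deriv_ne_zero hU hφU hφ0U) (image_mono hTU) ha hbψ
  obtain ⟨G, hG, hG0, hGh, hGk, hGm⟩ := exists_seq_entire_bridge hT hφT hTc
    (isPreconnected_compl_image hT hTc hΩ hTΩ hφ (hinj.mono hTU)) hdisj hk (mem_image_of_mem φ hm)
    (fun x hx => forall_mem_image.2 (hmin x hx)) hW hTW hh hne
  refine ⟨G, hG, hG0, hosc.tendstoUniformlyOn hΩ hTΩ (fun n => (hG n).differentiableOn) hf ?_ hk
    (by simp [hGk]), hosc.tendstoUniformlyOn hΩ hTΩ (fun n => (hG n).comp_differentiableOn hφ)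
    hg ?_ hm hGm⟩
  · refine (hGh.mono subset_union_left).congr_right fun z hz => ?_
    rw [Function.comp_apply, hha hz, hea z (hTΩ hz)]
  · refine (tendstoUniformlyOn_deriv_comp hΩ hT hTΩ hφ hG
      (hGh.mono subset_union_right)).congr_right fun z hz => ?_
    simp only [Function.comp_apply, hhb (mem_image_of_mem φ hz), hψ (hTU hz), heb z (hTΩ hz)]
    exact div_mul_cancel₀ _ (hφ0 z (hTΩ hz))

theorem exists_entire_approx_comp {Ω T U : Set ℂ} (hΩ : IsOpen Ω) (hc : IsSimplyConnected Ω)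
    (hT : IsCompact T) (hTne : T.Nonempty) (hTc : IsPreconnected Tᶜ) (hosc : HasOscBound Ω T)
    (hU : IsOpen U) (hTU : T ⊆ U) (hUΩ : U ⊆ Ω) {φ f g : ℂ → ℂ} (hφ : DifferentiableOn ℂ φ Ω)
    (hφ0 : ∀ z ∈ Ω, deriv φ z ≠ 0) (hinj : InjOn φ U) (hdisj : Disjoint T (φ '' T))
    (hf : DifferentiableOn ℂ f Ω) (hf0 : ∀ z ∈ Ω, deriv f z ≠ 0) (hg : DifferentiableOn ℂ g Ω)
    (hg0 : ∀ z ∈ Ω, deriv g z ≠ 0) {ε : ℝ} (hε : 0 < ε) :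
    ∃ G : ℂ → ℂ, Differentiable ℂ G ∧ (∀ z, deriv G z ≠ 0) ∧ (∀ z ∈ T, dist (f z) (G z) < ε) ∧
      ∀ z ∈ T, dist (g z) (G (φ z)) < ε := by
  have hdist : ContinuousOn (fun x : ℂ × ℂ => dist x.1 (φ x.2)) (T ×ˢ T) := by
    have hφT := hφ.continuousOn.mono (hTU.trans hUΩ)
    exact continuous_dist.comp_continuousOn
      (continuousOn_fst.prodMk (hφT.comp continuousOn_snd fun x hx => hx.2))
  obtain ⟨⟨k, m⟩, ⟨hk, hm⟩, hmin⟩ := (hT.prod hT).exists_isMinOn (hTne.prod hTne) hdist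
  obtain ⟨δ, hδε, hδ⟩ : ∃ δ, dist 0 δ < ε / 2 ∧ f k ≠ g m + δ := by
    obtain ⟨δ, hδ, hδε⟩ := (dense_compl_singleton (f k - g m)).exists_dist_lt 0 (half_pos hε)
    exact ⟨δ, hδε, fun h => hδ (eq_sub_of_add_eq' h.symm)⟩
  obtain ⟨G, hG, hG0, hGf, hGg⟩ := exists_seq_entire_approx_comp hΩ hc hT hTc hosc hU hTU hUΩ hφ
    hφ0 hinj hdisj hf hf0 (hg.add_const δ) (by simpa using hg0) hk hm
    (fun x hx y hy => hmin (mk_mem_prod hx hy)) hδ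
  obtain ⟨n, hnf, hng⟩ := ((Metric.tendstoUniformlyOn_iff.1 hGf ε hε).and
    (Metric.tendstoUniformlyOn_iff.1 hGg (ε / 2) (half_pos hε))).exists
  refine ⟨G n, hG n, hG0 n, hnf, fun z hz => ?_⟩
  calc dist (g z) (G n (φ z)) ≤ dist (g z) (g z + δ) + dist (g z + δ) (G n (φ z)) :=
        dist_triangle _ _ _
    _ < ε / 2 + ε / 2 := add_lt_add (by simpa using hδε) (hng z hz)
    _ = ε := add_halves ε

end Composition

/-! ### Universality -/

section Universality

theorem isGδ_image_val {X : Type*} [TopologicalSpace X] {s : Set X} (hs : IsGδ s) {t : Set s}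
    (ht : IsGδ t) : IsGδ (Subtype.val '' t) := by
  obtain ⟨f, hf, rfl⟩ := ht.eq_iInter_nat
  choose g hg hgf using fun n => isOpen_induced_iff.1 (hf n)
  simp_rw [← hgf, ← preimage_iInter, Subtype.image_preimage_coe]
  exact hs.inter (.iInter_of_isOpen hg)

theorem baireSpace_of_isGδ {X : Type*} [TopologicalSpace X] [IsCompletelyMetrizableSpace X]
    {s : Set X} (hs : IsGδ s) : BaireSpace s := by
  have : IsCompletelyMetrizableSpace (closure s) := isClosed_closure.isCompletelyMetrizableSpace
  have hG : IsGδ (range (inclusion (subset_closure : s ⊆ closure s))) := by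
    rw [range_inclusion]
    exact hs.preimage continuous_subtype_val
  have := hG.baireSpace_of_dense ((denseRange_inclusion_iff subset_closure).2 subset_rfl)
  exact (IsEmbedding.inclusion (subset_closure : s ⊆ closure s)).toHomeomorph.symm.baireSpace

variable {ι X Y : Type*} [TopologicalSpace Y] [SecondCountableTopology Y]

theorem setOf_denseRange_eq_biInter (T : ι → X → Y) :
    {x | DenseRange (T · x)} = ⋂ V ∈ countableBasis Y, ⋃ i, T i ⁻¹' V := by
  ext x
  simp only [mem_ofPred_eq, DenseRange, (isBasis_countableBasis Y).dense_iff, mem_iInter₂,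
    mem_iUnion, mem_preimage, inter_nonempty, mem_range]
  exact forall₂_congr fun V hV => ⟨fun h => by
    obtain ⟨_, hy, i, rfl⟩ := h (nonempty_of_mem_countableBasis hV)
    exact ⟨i, hy⟩, fun ⟨i, hi⟩ _ => ⟨_, hi, i, rfl⟩⟩

variable [TopologicalSpace X] {T : ι → X → Y}

theorem isGδ_setOf_denseRange (hT : ∀ i, Continuous (T i)) : IsGδ {x | DenseRange (T · x)} := by
  rw [setOf_denseRange_eq_biInter]
  exact .biInter_of_isOpen (countable_countableBasis Y) fun V hV =>
    isOpen_iUnion fun i => (isOpen_of_mem_countableBasis hV).preimage (hT i)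

theorem dense_setOf_denseRange [BaireSpace X] (hT : ∀ i, Continuous (T i))
    (htrans : ∀ U V, IsOpen U → U.Nonempty → IsOpen V → V.Nonempty →
      ∃ i, (U ∩ T i ⁻¹' V).Nonempty) :
    Dense {x | DenseRange (T · x)} := by
  rw [setOf_denseRange_eq_biInter]
  refine dense_biInter_of_isOpen (fun V hV => isOpen_iUnion fun i =>
    (isOpen_of_mem_countableBasis hV).preimage (hT i)) (countable_countableBasis Y) fun V hV => ?_
  refine dense_iff_inter_open.2 fun U hU hUne => ?_
  rw [inter_iUnion, nonempty_iUnion]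
  exact htrans U V hU hUne (isOpen_of_mem_countableBasis hV) (nonempty_of_mem_countableBasis hV)

end Universality

section FunctionSpace

theorem isGδ_setOf_forall_mem {X Y : Type*} [TopologicalSpace X] [SigmaCompactSpace X]
    [TopologicalSpace Y] {V : Set Y} (hV : IsOpen V) : IsGδ {f : C(X, Y) | ∀ x, f x ∈ V} := by
  have hcover : {f : C(X, Y) | ∀ x, f x ∈ V} =
      ⋂ n, {f : C(X, Y) | MapsTo f (compactCovering X n) V} := by
    ext f
    simp only [mem_iInter, mem_ofPred_eq]
    refine ⟨fun h n x _ => h x, fun h x => ?_⟩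
    obtain ⟨n, hn⟩ := exists_mem_compactCovering x
    exact h n hn
  rw [hcover]
  exact .iInter_of_isOpen fun n =>
    ContinuousMap.isOpen_setOfPred_mapsTo (isCompact_compactCovering X n) hV

theorem exists_isCompact_forall_dist_lt_mem {X Y : Type*} [TopologicalSpace X]
    [PseudoMetricSpace Y] {f : C(X, Y)} {V : Set C(X, Y)} (hV : V ∈ 𝓝 f) :
    ∃ K, IsCompact K ∧ ∃ ε > 0, ∀ g : C(X, Y), (∀ x ∈ K, dist (f x) (g x) < ε) → g ∈ V := by
  obtain ⟨⟨K, ε⟩, ⟨hK, hε⟩, hKV⟩ := (nhds_basis_uniformity'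
    Metric.uniformity_basis_dist.compactConvergenceUniformity).mem_iff.1 hV
  exact ⟨K, hK, ε, hε, fun g hg => hKV hg⟩

variable {Ω : Opens ℂ}

/-- The extension by zero of a function on `Ω` to the plane, which carries the holomorphy and the
derivative of the function. -/
noncomputable def extendZero (f : Ω → ℂ) : ℂ → ℂ := Function.extend Subtype.val f 0

theorem extendZero_coe (f : Ω → ℂ) (z : Ω) : extendZero f z = f z :=
  Subtype.val_injective.extend_apply f 0 z

theorem isLocallyUnivalent_iff_extendZero {f : Ω → ℂ} : IsLocallyUnivalent f ↔
    DifferentiableOn ℂ (extendZero f) Ω ∧ ∀ z : Ω, deriv (extendZero f) z ≠ 0 := by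
  refine ⟨?_, fun ⟨hd, h0⟩ => ⟨extendZero f, extendZero_coe f, hd, fun z hz => h0 ⟨z, hz⟩⟩⟩
  rintro ⟨F, hF, hd, h0⟩
  have heq : EqOn (extendZero f) F Ω := fun z hz => by
    rw [hF ⟨z, hz⟩, ← extendZero_coe f ⟨z, hz⟩]
  refine ⟨hd.congr heq, fun z => ?_⟩
  rw [(heq.eventuallyEq_of_mem (Ω.isOpen.mem_nhds z.2)).deriv_eq]
  exact h0 z z.2

/-- The holomorphic functions on `Ω`, as a subset of `C(Ω, ℂ)`. -/
def holomorphicMaps (Ω : Opens ℂ) : Set C(Ω, ℂ) :=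
  {f | DifferentiableOn ℂ (extendZero f) Ω}

instance instLocallyCompactSpaceOpens (Ω : Opens ℂ) : LocallyCompactSpace Ω :=
  Ω.isOpen.locallyCompactSpace

theorem tendstoLocallyUniformlyOn_extendZero {ι : Type*} {p : Filter ι} {F : ι → C(Ω, ℂ)}
    {f : C(Ω, ℂ)} (hF : Tendsto F p (𝓝 f)) :
    TendstoLocallyUniformlyOn (fun i => extendZero (F i)) (extendZero f) p Ω := by
  have hlim : TendstoLocallyUniformly (fun i (z : Ω) => extendZero (F i) z)
      (fun z : Ω => extendZero f z) p := by
    simpa only [extendZero_coe] using ContinuousMap.tendsto_iff_tendstoLocallyUniformly.1 hF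
  exact tendstoLocallyUniformlyOn_iff_tendstoLocallyUniformly_comp_coe.2 hlim

theorem isClosed_holomorphicMaps (Ω : Opens ℂ) : IsClosed (holomorphicMaps Ω) := by
  refine isClosed_of_closure_subset fun f hf => ?_
  have : (𝓝[holomorphicMaps Ω] f).NeBot := mem_closure_iff_nhdsWithin_neBot.1 hf
  exact (tendstoLocallyUniformlyOn_extendZero (tendsto_id.mono_left nhdsWithin_le_nhds)
    ).differentiableOn (eventually_mem_nhdsWithin (s := holomorphicMaps Ω)) Ω.isOpen

/-- Differentiation, as a map from the holomorphic functions on `Ω` to `C(Ω, ℂ)`. -/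
noncomputable def derivMap (f : holomorphicMaps Ω) : C(Ω, ℂ) where
  toFun z := deriv (extendZero f.1) z
  continuous_toFun := (DifferentiableOn.deriv f.2 Ω.isOpen).continuousOn.domRestrict

theorem continuous_derivMap : Continuous (derivMap (Ω := Ω)) := by
  refine continuous_iff_continuousAt.2 fun f => ?_
  have hlim := (tendstoLocallyUniformlyOn_extendZero (continuous_subtype_val.tendsto f)).deriv
    (.of_forall fun g : holomorphicMaps Ω => g.2) Ω.isOpen
  exact ContinuousMap.tendsto_iff_tendstoLocallyUniformly.2
    (tendstoLocallyUniformlyOn_iff_tendstoLocallyUniformly_comp_coe.1 hlim)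

theorem isGδ_Hlu (Ω : Opens ℂ) : IsGδ (Hlu Ω) := by
  have himage :
      Hlu Ω = Subtype.val '' (derivMap ⁻¹' {g : C(Ω, ℂ) | ∀ z, g z ∈ ({0} : Set ℂ)ᶜ}) := by
    ext f
    simp only [Hlu, mem_ofPred_eq, isLocallyUnivalent_iff_extendZero, Subtype.exists, mem_image,
      exists_and_right, exists_eq_right]
    exact ⟨fun ⟨hd, h0⟩ => ⟨hd, h0⟩, fun ⟨hd, h0⟩ => ⟨hd, h0⟩⟩
  rw [himage]
  exact isGδ_image_val (isClosed_holomorphicMaps Ω).isGδ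
    ((isGδ_setOf_forall_mem isOpen_compl_singleton).preimage continuous_derivMap)

theorem id_mem_Hlu (Ω : Opens ℂ) : (⟨Subtype.val, continuous_subtype_val⟩ : C(Ω, ℂ)) ∈ Hlu Ω :=
  ⟨fun z => z, fun _ => rfl, differentiableOn_id, fun z _ => by simp⟩

theorem comp_mem_Hlu {φ : C(Ω, Ω)} (hφ : IsLocallyUnivalentSelfMap φ) {G : C(Ω, ℂ)}
    (hG : G ∈ Hlu Ω) : G.comp φ ∈ Hlu Ω := by
  obtain ⟨F, hFG, hF, hF0⟩ := hG
  obtain ⟨f, hfφ, hf, hf0⟩ := hφ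
  have hmaps : MapsTo f Ω Ω := fun z hz => by
    rw [hfφ ⟨z, hz⟩]
    exact (φ ⟨z, hz⟩).2
  refine ⟨F ∘ f, fun z => ?_, hF.comp hf hmaps, fun z hz => ?_⟩
  · rw [Function.comp_apply, hfφ, hFG, ContinuousMap.comp_apply]
  · rw [deriv_comp z (hF.differentiableAt (Ω.isOpen.mem_nhds (hmaps hz)))
      (hf.differentiableAt (Ω.isOpen.mem_nhds hz))]
    exact mul_ne_zero (hF0 _ (hmaps hz)) (hf0 z hz)

/-- The composition operator `G ↦ G ∘ φ` on the locally univalent functions. -/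
noncomputable def compOperator {φ : C(Ω, Ω)} (hφ : IsLocallyUnivalentSelfMap φ) (G : Hlu Ω) :
    Hlu Ω :=
  ⟨(G : C(Ω, ℂ)).comp φ, comp_mem_Hlu hφ G.2⟩

theorem continuous_compOperator {φ : C(Ω, Ω)} (hφ : IsLocallyUnivalentSelfMap φ) :
    Continuous (compOperator hφ) :=
  ((ContinuousMap.continuous_precomp φ).comp continuous_subtype_val).subtype_mk _

theorem isUniversalIn_Hlu_iff_denseRange {Φ : Set C(Ω, Ω)}
    (hΦ : ∀ φ ∈ Φ, IsLocallyUnivalentSelfMap φ) (G : Hlu Ω) :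
    IsUniversalIn Φ (Hlu Ω) (G : C(Ω, ℂ)) ↔
      DenseRange fun φ : Φ => compOperator (hΦ φ φ.2) G := by
  have horbit : Subtype.val '' range (fun φ : Φ => compOperator (hΦ φ φ.2) G) = orbit Φ G := by
    rw [← range_comp]
    ext g
    exact ⟨fun ⟨φ, h⟩ => ⟨φ, φ.2, h.symm⟩, fun ⟨φ, hφ, h⟩ => ⟨⟨φ, hφ⟩, h.symm⟩⟩
  rw [DenseRange, IsInducing.subtypeVal.dense_iff, horbit]
  refine ⟨fun h g => h.2.2 g.2, fun h => ⟨G.2, ?_, fun g hg => h ⟨g, hg⟩⟩⟩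
  rintro _ ⟨φ, hφ, rfl⟩
  exact comp_mem_Hlu (hΦ φ hφ) G.2

end FunctionSpace

section Transitivity

variable {Ω : Opens ℂ}

theorem exists_injOn_disjoint_image [Nonempty Ω] {φ : ℕ → C(Ω, Ω)} (hr : IsRunAway φ)
    (hi : IsEventuallyInjective φ) {K : Set Ω} (hK : IsCompact K) :
    ∃ n, InjOn (φ n) K ∧ Disjoint (φ n '' K) K := by
  obtain ⟨N, hN⟩ := hi K hK
  obtain ⟨z₀⟩ := ‹Nonempty Ω›
  -- Adding `z₀` and its images under the first `N` maps to `K` forces the run-away index past `N`.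
  have hK' : IsCompact (K ∪ insert z₀ ((φ · z₀) '' Iio N)) :=
    hK.union (((finite_Iio N).image _).insert z₀).isCompact
  obtain ⟨n, hn⟩ := hr _ hK'
  rw [← disjoint_iff_inter_eq_empty] at hn
  refine ⟨n, hN n (not_lt.1 fun hnN => ?_), hn.mono (image_mono subset_union_left)
    subset_union_left⟩
  exact disjoint_left.1 hn (mem_image_of_mem _ (.inr (mem_insert _ _)))
    (.inr (.inr ⟨n, hnN, rfl⟩))

theorem exists_injOn_open_disjoint_image [Nonempty Ω] {φ : ℕ → C(Ω, Ω)} (hr : IsRunAway φ)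
    (hi : IsEventuallyInjective φ) {K : Set Ω} (hK : IsCompact K) :
    ∃ n U, IsOpen U ∧ K ⊆ U ∧ InjOn (φ n) U ∧ Disjoint K (φ n '' K) := by
  obtain ⟨L, hL, hKL⟩ := exists_compact_superset hK
  obtain ⟨n, hinj, hdisj⟩ := exists_injOn_disjoint_image hr hi hL
  have hKL' := hKL.trans interior_subset
  exact ⟨n, interior L, isOpen_interior, hKL, hinj.mono interior_subset,
    (hdisj.mono (image_mono hKL') hKL').symm⟩

theorem exists_mem_Hlu_approx_comp [SimplyConnectedSpace Ω] {K U : Set Ω} (hK : IsCompact K)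
    (hKne : K.Nonempty) (hKc : IsPreconnected (Subtype.val '' K : Set ℂ)ᶜ)
    (hosc : HasOscBound Ω (Subtype.val '' K)) (hU : IsOpen U) (hKU : K ⊆ U) {φ : C(Ω, Ω)}
    (hφ : IsLocallyUnivalentSelfMap φ) (hinj : InjOn φ U) (hdisj : Disjoint K (φ '' K))
    {f g : C(Ω, ℂ)} (hf : f ∈ Hlu Ω) (hg : g ∈ Hlu Ω) {ε : ℝ} (hε : 0 < ε) :
    ∃ G ∈ Hlu Ω, (∀ z ∈ K, dist (f z) (G z) < ε) ∧ ∀ z ∈ K, dist (g z) (G (φ z)) < ε := by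
  obtain ⟨F, (hFφ : ∀ z : Ω, F z = φ z), hF, hF0⟩ := hφ
  obtain ⟨f', hf'f, hf', hf'0⟩ := hf
  obtain ⟨g', hg'g, hg', hg'0⟩ := hg
  have hcomp : F ∘ Subtype.val = Subtype.val ∘ φ := funext hFφ
  have hFinj : InjOn F (Subtype.val '' U) := by
    apply InjOn.image_of_comp
    rw [hcomp]
    exact Subtype.val_injective.comp_injOn hinj
  have hFdisj : Disjoint (Subtype.val '' K) (F '' (Subtype.val '' K)) := by
    rw [← image_comp, hcomp, image_comp]
    exact (disjoint_image_iff Subtype.val_injective).2 hdisj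
  obtain ⟨G, hG, hG0, hGf, hGg⟩ := exists_entire_approx_comp Ω.isOpen
    (‹SimplyConnectedSpace Ω› : IsSimplyConnected (Ω : Set ℂ))
    (hK.image continuous_subtype_val) (hKne.image _) hKc hosc
    (Ω.isOpen.isOpenMap_subtype_val U hU) (image_mono hKU) (Subtype.coe_image_subset _ U) hF hF0
    hFinj hFdisj hf' hf'0 hg' hg'0 hε
  refine ⟨⟨G ∘ Subtype.val, hG.continuous.comp continuous_subtype_val⟩,
    ⟨G, fun _ => rfl, hG.differentiableOn, fun z _ => hG0 z⟩, fun z hz => ?_, fun z hz => ?_⟩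
  · rw [← hf'f]
    exact hGf z (mem_image_of_mem _ hz)
  · have hgG := hGg z (mem_image_of_mem _ hz)
    rwa [hg'g, hFφ] at hgG

theorem exists_mem_Hlu_approx [SimplyConnectedSpace Ω] {φ : ℕ → C(Ω, Ω)}
    (hφ : ∀ n, IsLocallyUnivalentSelfMap (φ n)) (hr : IsRunAway φ)
    (hi : IsEventuallyInjective φ) {f g : C(Ω, ℂ)} (hf : f ∈ Hlu Ω) (hg : g ∈ Hlu Ω) {K : Set Ω}
    (hK : IsCompact K) {ε : ℝ} (hε : 0 < ε) :
    ∃ n, ∃ G ∈ Hlu Ω, (∀ z ∈ K, dist (f z) (G z) < ε) ∧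
      ∀ z ∈ K, dist (g z) (G (φ n z)) < ε := by
  obtain ⟨T, hT, hTΩ, hosc, hTne, hTc, hKT⟩ := exists_isCompact_hasOscBound_isPreconnected_compl
    Ω.isOpen (‹SimplyConnectedSpace Ω› : IsSimplyConnected (Ω : Set ℂ))
    (hK.image continuous_subtype_val) (Subtype.coe_image_subset _ K)
  obtain ⟨S, rfl⟩ : ∃ S : Set Ω, Subtype.val '' S = T :=
    ⟨_, image_preimage_eq_of_subset (by simpa using hTΩ)⟩
  have hS : IsCompact S := Subtype.isCompact_iff.2 hT
  obtain ⟨n, U, hU, hSU, hinj, hdisj⟩ := exists_injOn_open_disjoint_image hr hi hS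
  obtain ⟨G, hG, hGf, hGg⟩ := exists_mem_Hlu_approx_comp hS hTne.of_image hTc hosc hU hSU (hφ n)
    hinj hdisj hf hg hε
  have hKS := (image_subset_image_iff Subtype.val_injective).1 hKT
  exact ⟨n, G, hG, fun z hz => hGf z (hKS hz), fun z hz => hGg z (hKS hz)⟩

theorem exists_nonempty_inter_preimage_compOperator [SimplyConnectedSpace Ω] {φ : ℕ → C(Ω, Ω)}
    (hφ : ∀ n, IsLocallyUnivalentSelfMap (φ n)) (hr : IsRunAway φ)
    (hi : IsEventuallyInjective φ) {U V : Set (Hlu Ω)} (hU : IsOpen U) (hUne : U.Nonempty)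
    (hV : IsOpen V) (hVne : V.Nonempty) : ∃ n, (U ∩ compOperator (hφ n) ⁻¹' V).Nonempty := by
  obtain ⟨U, hU, rfl⟩ := hU
  obtain ⟨V, hV, rfl⟩ := hV
  obtain ⟨⟨f, hf⟩, hfU⟩ := hUne
  obtain ⟨⟨g, hg⟩, hgV⟩ := hVne
  obtain ⟨K, hK, ε, hε, hKU⟩ := exists_isCompact_forall_dist_lt_mem (hU.mem_nhds hfU)
  obtain ⟨L, hL, δ, hδ, hLV⟩ := exists_isCompact_forall_dist_lt_mem (hV.mem_nhds hgV)
  obtain ⟨n, G, hG, hGf, hGg⟩ := exists_mem_Hlu_approx hφ hr hi hf hg (hK.union hL)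
    (lt_min hε hδ)
  exact ⟨n, ⟨G, hG⟩, hKU G fun z hz => (hGf z (.inl hz)).trans_le (min_le_left _ _),
    hLV _ fun z hz => (hGg z (.inr hz)).trans_le (min_le_right _ _)⟩

end Transitivity

end LocUniv

theorem mainTheorem5 (Ω : TopologicalSpace.Opens ℂ) [SimplyConnectedSpace Ω]
    (Φ : Set C(Ω, Ω)) (hΦ : ∀ φ ∈ Φ, LocUniv.IsLocallyUnivalentSelfMap φ)
    (hseq : ∃ φ : ℕ → C(Ω, Ω), (∀ n, φ n ∈ Φ) ∧
      LocUniv.IsRunAway φ ∧ LocUniv.IsEventuallyInjective φ) :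
    (∃ G : C(Ω, ℂ), LocUniv.IsUniversalIn Φ (LocUniv.Hlu Ω) G) ∧
      IsGδ {G : LocUniv.Hlu Ω | LocUniv.IsUniversalIn Φ (LocUniv.Hlu Ω) (G : C(Ω, ℂ))} ∧
      Dense {G : LocUniv.Hlu Ω | LocUniv.IsUniversalIn Φ (LocUniv.Hlu Ω) (G : C(Ω, ℂ))} := by
  obtain ⟨φ, hφ, hr, hi⟩ := hseq
  have : BaireSpace (LocUniv.Hlu Ω) := LocUniv.baireSpace_of_isGδ (LocUniv.isGδ_Hlu Ω)
  have hcont : ∀ ψ : Φ, Continuous (LocUniv.compOperator (hΦ ψ ψ.2)) := fun ψ =>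
    LocUniv.continuous_compOperator _
  have hdense := LocUniv.dense_setOf_denseRange hcont fun U V hU hUne hV hVne =>
    have ⟨n, hn⟩ := LocUniv.exists_nonempty_inter_preimage_compOperator (fun n => hΦ _ (hφ n)) hr
      hi hU hUne hV hVne
    ⟨⟨φ n, hφ n⟩, hn⟩
  simp only [← LocUniv.isUniversalIn_Hlu_iff_denseRange] at hdense
  have : Nonempty (LocUniv.Hlu Ω) := ⟨⟨_, LocUniv.id_mem_Hlu Ω⟩⟩
  obtain ⟨G, hG⟩ := hdense.nonempty
  refine ⟨⟨G, hG⟩, ?_, hdense⟩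
  simpa only [LocUniv.isUniversalIn_Hlu_iff_denseRange hΦ] using
    LocUniv.isGδ_setOf_denseRange hcont
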